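/- Let $\gamma>-\tfrac12$ be real, let $\mu\ge 1$ be an integer, let $g_1$ be a real-valued function that is analytic on $[-1,1]$, and let $$f(x)=(1-x)^{\gamma}\,\ln^{\mu}(1-x)\,g_1(x),\qquad x\in[-1,1).$$ For $k\ge 0$ let $$a_k=\frac{2}{\pi}\int_{-1}^{1}\frac{f(x)\,T_k(x)}{\sqrt{1-x^2}}\,dx$$ be the Chebyshev coefficients of $f$, where $T_k(x)=\cos(k\arccos x)$ is the Chebyshev polynomial of the first kind. Then these integrals converge absolutely, and as $k\to\infty$ $$\begin{aligned} a_k={}&\frac{2^{\mu+1-\gamma}}{\pi}\,g_1(1)\,(-1)^{\mu+1}\sin(\gamma\pi)\,\Gamma(2\gamma+1)\,\frac{\ln^{\mu}k}{k^{2\gamma+1}}\\ &+(-1)^{\mu}\,\mu\,2^{\mu-\gamma}\,g_1(1)\left(\frac{2}{\pi}\sin(\gamma\pi)\,\Gamma'(2\gamma+1)+\Bigl(\cos(\gamma\pi)-\frac{\ln 2}{\pi}\sin(\gamma\pi)\Bigr)\Gamma(2\gamma+1)\right)\frac{\ln^{\mu-1}k}{k^{2\gamma+1}}\\ &+\mathcal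 O\!\left(\frac{\ln^{\mu-2}k}{k^{2\gamma+1}}\right), \end{aligned}$$ where the implied constant may depend on $\gamma$, $\mu$ and $g_1$. -/

import Mathlib

open Filter Asymptotics Set

/-- The integrand `f(x) T_k(x) / √(1 - x²)` of the `k`-th Chebyshev coefficient of `f`, where `T_k`
is the Chebyshev polynomial of the first kind. -/
noncomputable def chebyshevIntegrand (f : ℝ → ℝ) (k : ℕ) (x : ℝ) : ℝ :=
  f x * (Polynomial.Chebyshev.T ℝ (k : ℤ)).eval x * (1 / Real.sqrt (1 - x ^ 2))

/-- The `k`-th Chebyshev coefficient `a_k = (2/π) ∫_{-1}^{1} f(x) T_k(x) / √(1 - x²) dx` of `f`. -/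
noncomputable def chebyshevCoeff (f : ℝ → ℝ) (k : ℕ) : ℝ :=
  2 / Real.pi * ∫ x in (-1 : ℝ)..1, chebyshevIntegrand f k x

/-! The substitution `x = cos θ` turns `a_k` into `2/π` times the integral over `[0, π]` of `(1 -
cos θ)^γ log^μ(1 - cos θ) g₁(cos θ) cos kθ`. Two ideas then give the expansion.

Logarithms are derivatives in the exponent. For complex `s` with `Re s > -1/2`, the moment
`cosMoment 0 k s` is holomorphic, and its `μ`-th derivative at `γ` carries the factor `log^μ`.
Without logarithms the moments obey a two-term recurrence in `k` (`cosMoment_succ`), and the moment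
at `k = 0` is a Beta integral. Hence `k^(2s+1)` times the moment tends to an explicit function
`Λ(s)` (`cosMomentLimit`), with error `O(1/k)` uniformly for `s` near `γ`
(`exists_norm_cosMoment_mul_cpow_sub_le`). Subtract `k^(-2s-1)` times the linear Taylor polynomial
of `Λ` at `γ`. On the circle of radius `1/log k` about `γ` the remainder is `O(log^(-2) k)` relative
to `k^(-2γ-1)`, so Cauchy's estimate bounds its `μ`-th derivative by the required `log^(μ-2) k`. The
derivative of the subtracted term gives the two main terms (`exists_norm_cosMoment_sub_le`).

The factor `g₁` enters only through `g₁(1)`. Since `g₁(cos θ)` is smooth, even and periodic, it has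
a cosine series with rapidly decreasing coefficients, and multiplication by `cos nθ` averages the
moments at `k + n` and `k - n`. Consecutive moments differ by `O(k^(-2γ-3/2))`, so these shifts cost
less than the error term (`exists_abs_integral_weight_mul_sub_le`). -/

/-! ### Integrable bounds for the weight -/

lemma abs_log_mul_rpow_le {b t : ℝ} (hb : b ∈ Ioc (0 : ℝ) 2) (ht : 0 < t) :
    |Real.log b| * b ^ t ≤ 1 / t + 2 ^ t := by
  have h2 : (0 : ℝ) < 2 ^ t := by positivity
  rcases le_total b 1 with h | h
  · have := Real.abs_log_mul_self_rpow_lt b t hb.1 h ht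
    rw [abs_mul, abs_of_pos (Real.rpow_pos_of_pos hb.1 t)] at this
    linarith
  · have hl : |Real.log b| ≤ 1 := by
      rw [abs_of_nonneg (Real.log_nonneg h)]
      have := Real.log_le_sub_one_of_pos hb.1
      linarith [hb.2]
    have hp : b ^ t ≤ 2 ^ t := Real.rpow_le_rpow hb.1.le hb.2 ht.le
    have : |Real.log b| * b ^ t ≤ 1 * 2 ^ t :=
      mul_le_mul hl hp (Real.rpow_nonneg hb.1.le _) zero_le_one
    have : 0 < 1 / t := by positivity
    linarith

lemma exists_rpow_mul_abs_log_pow_le {σ₀ σ₁ τ : ℝ} (h : τ < σ₀) (m : ℕ) :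
    ∃ C : ℝ, 0 ≤ C ∧ ∀ b ∈ Ioc (0 : ℝ) 2, ∀ σ ∈ Icc σ₀ σ₁,
      b ^ σ * |Real.log b| ^ m ≤ C * b ^ τ := by
  -- The slack `σ₀ - τ` is cut into `m + 1` equal shares: one for each logarithm and one spare,
  -- which keeps the quotient meaningful at `m = 0`.
  set t : ℝ := (σ₀ - τ) / (m + 1) with htdef
  have hm : (0 : ℝ) < m + 1 := by positivity
  have ht : 0 < t := div_pos (by linarith) hm
  refine ⟨(1 / t + 2 ^ t) ^ m * 2 ^ t * 2 ^ (σ₁ - σ₀), by positivity, fun b hb σ hσ ↦ ?_⟩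
  have hsplit : b ^ σ = b ^ τ * (b ^ t) ^ m * b ^ t * b ^ (σ - σ₀) := by
    rw [← Real.rpow_natCast, ← Real.rpow_mul hb.1.le, ← Real.rpow_add hb.1, ← Real.rpow_add hb.1,
      ← Real.rpow_add hb.1]
    congr 1
    have : t * (m + 1) = σ₀ - τ := by rw [htdef]; field_simp
    linarith
  have h1 := pow_le_pow_left₀ (by have := hb.1; positivity) (abs_log_mul_rpow_le hb ht) m
  have h2 : b ^ t ≤ 2 ^ t := Real.rpow_le_rpow hb.1.le hb.2 ht.le
  have h3 : b ^ (σ - σ₀) ≤ 2 ^ (σ₁ - σ₀) :=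
    (Real.rpow_le_rpow hb.1.le hb.2 (by linarith [hσ.1])).trans
      (Real.rpow_le_rpow_of_exponent_le (by norm_num) (by linarith [hσ.2]))
  have hb0 := hb.1
  calc b ^ σ * |Real.log b| ^ m
      = ((|Real.log b| * b ^ t) ^ m * b ^ t * b ^ (σ - σ₀)) * b ^ τ := by rw [hsplit]; ring
    _ ≤ _ := by gcongr

lemma one_sub_cos_mem_Ioc {θ : ℝ} (hθ : θ ∈ Ioc 0 Real.pi) : 1 - Real.cos θ ∈ Ioc (0 : ℝ) 2 := by
  have h := Real.cos_le_one_sub_mul_cos_sq (x := θ) (by rw [abs_of_pos hθ.1]; exact hθ.2)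
  have : 0 < 2 / Real.pi ^ 2 * θ ^ 2 := by have := hθ.1; positivity
  constructor <;> linarith [Real.neg_one_le_cos θ]

/-- On `(0, π]` the functions `(1 - cos θ) ^ σ * |log (1 - cos θ)| ^ m`, with `σ` in a compact
subset of `(-1/2, ∞)`, have a common integrable majorant. -/
lemma exists_integrable_majorant {σ₀ : ℝ} (σ₁ : ℝ) (h : -(1 / 2 : ℝ) < σ₀) (m : ℕ) :
    ∃ g : ℝ → ℝ, IntervalIntegrable g MeasureTheory.volume 0 Real.pi ∧
      ∀ θ ∈ Ioc 0 Real.pi, ∀ σ ∈ Icc σ₀ σ₁,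
        (1 - Real.cos θ) ^ σ * |Real.log (1 - Real.cos θ)| ^ m ≤ g θ := by
  -- The midpoint of `-1/2` and `min σ₀ 0`: below `σ₀`, negative so that the lower bound `1 - cos θ
  -- ≥ 2θ²/π²` can be used, and with `2τ > -1` for integrability.
  set τ : ℝ := (min σ₀ 0 - 1 / 2) / 2 with hτ
  have h1 : -(1 / 2 : ℝ) < min σ₀ 0 := lt_min h (by norm_num)
  have h2 : min σ₀ 0 ≤ σ₀ := min_le_left _ _
  have h3 : min σ₀ 0 ≤ 0 := min_le_right _ _
  obtain ⟨C, hC, hb⟩ := exists_rpow_mul_abs_log_pow_le (σ₁ := σ₁) (show τ < σ₀ by linarith) m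
  refine ⟨fun θ ↦ C * (2 / Real.pi ^ 2) ^ τ * θ ^ (2 * τ),
    (intervalIntegral.intervalIntegrable_rpow' (by linarith)).const_mul _, fun θ hθ σ hσ ↦ ?_⟩
  have hθ0 := hθ.1
  refine (hb _ (one_sub_cos_mem_Ioc hθ) σ hσ).trans ?_
  change C * _ ≤ C * _ * _
  rw [mul_assoc]
  refine mul_le_mul_of_nonneg_left ?_ hC
  have hJ := Real.cos_le_one_sub_mul_cos_sq (x := θ) (by rw [abs_of_pos hθ.1]; exact hθ.2)
  refine (Real.rpow_le_rpow_of_nonpos (show 0 < 2 / Real.pi ^ 2 * θ ^ 2 by positivity)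
    (by linarith) (by linarith)).trans_eq ?_
  rw [Real.mul_rpow (by positivity) (by positivity), Real.rpow_mul hθ0.le, Real.rpow_two]

/-! ### Moments as holomorphic functions of the exponent -/

/-- The weight `(1 - cos θ) ^ s * log (1 - cos θ) ^ m`. -/
noncomputable def logWeight (m : ℕ) (s : ℂ) (θ : ℝ) : ℂ :=
  ((1 - Real.cos θ : ℝ) : ℂ) ^ s * (Real.log (1 - Real.cos θ) : ℂ) ^ m

/-- The cosine moments of `logWeight` on `[0, π]`. -/
noncomputable def cosMoment (m : ℕ) (n : ℤ) (s : ℂ) : ℂ :=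
  ∫ θ in (0 : ℝ)..Real.pi, logWeight m s θ * (Real.cos (n * θ) : ℂ)

lemma norm_logWeight (m : ℕ) (s : ℂ) {θ : ℝ} (hθ : θ ∈ Ioc 0 Real.pi) :
    ‖logWeight m s θ‖ = (1 - Real.cos θ) ^ s.re * |Real.log (1 - Real.cos θ)| ^ m := by
  rw [logWeight, norm_mul, Complex.norm_cpow_eq_rpow_re_of_pos (one_sub_cos_mem_Ioc hθ).1, norm_pow,
    Complex.norm_real, Real.norm_eq_abs]

lemma measurable_logWeight (m : ℕ) (s : ℂ) : Measurable (logWeight m s) := by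
  unfold logWeight
  fun_prop

lemma intervalIntegrable_logWeight_mul (m : ℕ) {s : ℂ} (hs : -(1 / 2 : ℝ) < s.re) {u : ℝ → ℂ}
    (hu : Continuous u) :
    IntervalIntegrable (fun θ ↦ logWeight m s θ * u θ) MeasureTheory.volume 0 Real.pi := by
  refine IntervalIntegrable.mul_continuousOn ?_ hu.continuousOn
  obtain ⟨g, hg, hb⟩ := exists_integrable_majorant s.re hs m
  refine hg.mono_fun (measurable_logWeight m s).aestronglyMeasurable ?_
  rw [uIoc_of_le Real.pi_pos.le]
  filter_upwards [MeasureTheory.ae_restrict_mem measurableSet_Ioc] with θ hθ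
  rw [norm_logWeight m s hθ]
  exact (hb θ hθ _ ⟨le_rfl, le_rfl⟩).trans (le_abs_self _)

lemma hasDerivAt_logWeight (m : ℕ) (s : ℂ) {θ : ℝ} (hθ : θ ∈ Ioc 0 Real.pi) :
    HasDerivAt (fun z ↦ logWeight m z θ) (logWeight (m + 1) s θ) s := by
  have h0 := (one_sub_cos_mem_Ioc hθ).1
  have h := ((Complex.hasStrictDerivAt_const_cpow (y := s) (Or.inl (Complex.ofReal_ne_zero.mpr h0.ne'))
    ).hasDerivAt).mul_const ((Real.log (1 - Real.cos θ) : ℂ) ^ m)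
  refine h.congr_deriv ?_
  rw [logWeight, Complex.ofReal_log h0.le, pow_succ']
  ring

lemma hasDerivAt_cosMoment (m : ℕ) (n : ℤ) {s : ℂ} (hs : -(1 / 2 : ℝ) < s.re) :
    HasDerivAt (cosMoment m n) (cosMoment (m + 1) n s) s := by
  obtain ⟨ε, hε, hεs⟩ : ∃ ε : ℝ, 0 < ε ∧ -(1 / 2 : ℝ) < s.re - ε :=
    ⟨(s.re + 1 / 2) / 2, by linarith, by linarith⟩
  obtain ⟨g, hg, hb⟩ := exists_integrable_majorant (s.re + ε) hεs (m + 1)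
  refine (intervalIntegral.hasDerivAt_integral_of_dominated_loc_of_deriv_le
    (F := fun z θ ↦ logWeight m z θ * (Real.cos (n * θ) : ℂ))
    (F' := fun z θ ↦ logWeight (m + 1) z θ * (Real.cos (n * θ) : ℂ))
    (bound := g) (Metric.ball_mem_nhds s hε) ?_ ?_ ?_ ?_ hg ?_).2
  · refine Eventually.of_forall fun z ↦ ?_
    exact ((measurable_logWeight m z).mul (by fun_prop)).aestronglyMeasurable
  · exact intervalIntegrable_logWeight_mul m hs (by fun_prop)
  · exact ((measurable_logWeight (m + 1) s).mul (by fun_prop)).aestronglyMeasurable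
  · refine Eventually.of_forall fun θ hθ z hz ↦ ?_
    rw [uIoc_of_le Real.pi_pos.le] at hθ
    rw [norm_mul, norm_logWeight _ _ hθ, Complex.norm_real, Real.norm_eq_abs]
    have hre : |z.re - s.re| < ε := by
      rw [← Complex.sub_re]
      exact (Complex.abs_re_le_norm _).trans_lt (by simpa [dist_eq_norm] using hz)
    rw [abs_lt] at hre
    have hbθ := hb θ hθ z.re ⟨by linarith, by linarith⟩
    refine (mul_le_of_le_one_right ?_ (Real.abs_cos_le_one _)).trans hbθ
    have := (one_sub_cos_mem_Ioc hθ).1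
    positivity
  · refine Eventually.of_forall fun θ hθ z _ ↦ ?_
    rw [uIoc_of_le Real.pi_pos.le] at hθ
    exact (hasDerivAt_logWeight m z hθ).mul_const _

lemma isOpen_neg_half_lt_re : IsOpen {s : ℂ | -(1 / 2 : ℝ) < s.re} :=
  isOpen_lt continuous_const Complex.continuous_re

lemma differentiableOn_cosMoment (m : ℕ) (n : ℤ) :
    DifferentiableOn ℂ (cosMoment m n) {s : ℂ | -(1 / 2 : ℝ) < s.re} :=
  fun _ hs ↦ (hasDerivAt_cosMoment m n hs).differentiableAt.differentiableWithinAt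

lemma iteratedDeriv_cosMoment (m : ℕ) (n : ℤ) {s : ℂ} (hs : -(1 / 2 : ℝ) < s.re) :
    iteratedDeriv m (cosMoment 0 n) s = cosMoment m n s := by
  induction m generalizing s with
  | zero => simp
  | succ m ih =>
    rw [iteratedDeriv_succ]
    have : iteratedDeriv m (cosMoment 0 n) =ᶠ[nhds s] cosMoment m n := by
      filter_upwards [isOpen_neg_half_lt_re.mem_nhds hs] with z hz using ih hz
    rw [this.deriv_eq]
    exact (hasDerivAt_cosMoment m n hs).deriv

/-! ### Recurrence in `k` and the initial Beta integral -/

/-- This is the primitive behind the recurrence. Differentiating the weight lowers its exponent by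
one, but `sin θ` times the difference of sines contains a factor `1 - cos θ`, which restores it. -/
lemma hasDerivAt_logWeight_mul_sin_sub_sin (k : ℕ) (s : ℂ) {θ : ℝ} (hθ : θ ∈ Ioc 0 Real.pi) :
    HasDerivAt
      (fun θ ↦ logWeight 0 s θ * ((Real.sin ((k + 1) * θ) - Real.sin (k * θ) : ℝ) : ℂ))
      ((k + 1 + s) * (logWeight 0 s θ * (Real.cos (((k + 1 : ℕ) : ℤ) * θ) : ℂ)) -
        (k - s) * (logWeight 0 s θ * (Real.cos (((k : ℕ) : ℤ) * θ) : ℂ))) θ := by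
  have hb := (one_sub_cos_mem_Ioc hθ).1
  have hb' : ((1 - Real.cos θ : ℝ) : ℂ) ≠ 0 := Complex.ofReal_ne_zero.mpr hb.ne'
  have h1 : HasDerivAt (fun θ : ℝ ↦ ((1 - Real.cos θ : ℝ) : ℂ)) ((Real.sin θ : ℝ) : ℂ) θ := by
    simpa using ((Real.hasDerivAt_cos θ).const_sub 1).ofReal_comp
  have h2 : HasDerivAt (fun θ : ℝ ↦ ((1 - Real.cos θ : ℝ) : ℂ) ^ s)
      (s * ((1 - Real.cos θ : ℝ) : ℂ) ^ (s - 1) * ((Real.sin θ : ℝ) : ℂ)) θ :=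
    HasDerivAt.comp (h₂ := fun z : ℂ ↦ z ^ s) θ
      (Complex.hasStrictDerivAt_cpow_const (Complex.ofReal_mem_slitPlane.mpr hb)).hasDerivAt h1
  have h3 : HasDerivAt (fun θ : ℝ ↦ Real.sin ((k + 1) * θ) - Real.sin (k * θ))
      (Real.cos ((k + 1) * θ) * (k + 1) - Real.cos (k * θ) * k) θ := by
    simpa using! (((hasDerivAt_id θ).const_mul ((k : ℝ) + 1)).sin).sub
      (((hasDerivAt_id θ).const_mul (k : ℝ)).sin)
  have h4 := h2.mul h3.ofReal_comp
  have hfun : (fun θ ↦ logWeight 0 s θ * ((Real.sin ((k + 1) * θ) - Real.sin (k * θ) : ℝ) : ℂ)) =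
      fun θ : ℝ ↦ ((1 - Real.cos θ : ℝ) : ℂ) ^ s *
        ((Real.sin ((k + 1) * θ) - Real.sin (k * θ) : ℝ) : ℂ) := by
    funext θ; simp [logWeight]
  rw [hfun]
  refine h4.congr_deriv ?_
  have htrig : Real.sin θ * (Real.sin ((k + 1) * θ) - Real.sin (k * θ)) =
      (1 - Real.cos θ) * (Real.cos ((k + 1) * θ) + Real.cos (k * θ)) := by
    have e : ((k : ℝ) + 1) * θ = k * θ + θ := by ring
    rw [e, Real.sin_add, Real.cos_add]
    linear_combination Real.cos (k * θ) * Real.sin_sq_add_cos_sq θ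
  have htrigC := congrArg (fun x : ℝ ↦ (x : ℂ)) htrig
  rw [Complex.cpow_sub _ _ hb', Complex.cpow_one]
  simp only [logWeight, pow_zero, mul_one]
  push_cast at htrigC hb' ⊢
  field_simp
  linear_combination (1 - Complex.cos θ) ^ s * s * htrigC

/-- The difference of sines is at most the chord `|e^(iθ) - 1| = √(2(1 - cos θ))`. This gains `1/2`
in the exponent, exactly enough for the boundary term at `θ = 0` to vanish when `Re s > -1/2`. -/
lemma norm_logWeight_mul_sin_sub_sin_le (k : ℕ) (s : ℂ) (θ : ℝ) :
    ‖logWeight 0 s θ * ((Real.sin ((k + 1) * θ) - Real.sin (k * θ) : ℝ) : ℂ)‖ ≤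
      √2 * (1 - Real.cos θ) ^ (s.re + 1 / 2) := by
  have hsq : (Real.sin ((k + 1) * θ) - Real.sin (k * θ)) ^ 2 ≤ 2 * (1 - Real.cos θ) := by
    have e : ((k : ℝ) + 1) * θ = k * θ + θ := by ring
    rw [e, Real.sin_add]
    have h1 := Real.sin_sq_add_cos_sq θ
    have h2 := Real.sin_sq_add_cos_sq (k * θ)
    have h3 : 2 * (1 - Real.cos θ) - (Real.sin (k * θ) * Real.cos θ + Real.cos (k * θ) * Real.sin θ
        - Real.sin (k * θ)) ^ 2 =
        (Real.cos (k * θ) * (1 - Real.cos θ) + Real.sin (k * θ) * Real.sin θ) ^ 2 := by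
      linear_combination -((1 - Real.cos θ) ^ 2 + Real.sin θ ^ 2) * h2 - h1
    nlinarith [sq_nonneg (Real.cos (k * θ) * (1 - Real.cos θ) + Real.sin (k * θ) * Real.sin θ)]
  have habs : |Real.sin ((k + 1) * θ) - Real.sin (k * θ)| ≤ √(2 * (1 - Real.cos θ)) :=
    Real.abs_le_sqrt hsq
  have hb : 0 ≤ 1 - Real.cos θ := by linarith [Real.cos_le_one θ]
  rw [norm_mul, Complex.norm_real, Real.norm_eq_abs]
  rcases hb.eq_or_lt with h0 | h0
  · rw [← h0, mul_zero, Real.sqrt_zero] at habs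
    rw [le_antisymm habs (abs_nonneg _), mul_zero]
    positivity
  · rw [logWeight, pow_zero, mul_one, Complex.norm_cpow_eq_rpow_re_of_pos h0,
      Real.rpow_add h0, ← Real.sqrt_eq_rpow]
    rw [Real.sqrt_mul (by norm_num)] at habs
    calc _ ≤ (1 - Real.cos θ) ^ s.re * (√2 * √(1 - Real.cos θ)) := by gcongr
      _ = _ := by ring

/-- Contiguity relation between consecutive moments. -/
lemma cosMoment_succ (k : ℕ) {s : ℂ} (hs : -(1 / 2 : ℝ) < s.re) :
    (k + 1 + s) * cosMoment 0 (k + 1 : ℕ) s = (k - s) * cosMoment 0 k s := by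
  have hI1 := intervalIntegrable_logWeight_mul 0 hs
    (u := fun θ ↦ ((Real.cos (((k + 1 : ℕ) : ℤ) * θ) : ℝ) : ℂ)) (by fun_prop)
  have hI0 := intervalIntegrable_logWeight_mul 0 hs
    (u := fun θ ↦ ((Real.cos (((k : ℕ) : ℤ) * θ) : ℝ) : ℂ)) (by fun_prop)
  have key := intervalIntegral.integral_eq_sub_of_hasDerivAt_of_le Real.pi_pos.le
    (f := fun θ ↦ logWeight 0 s θ * ((Real.sin ((k + 1) * θ) - Real.sin (k * θ) : ℝ) : ℂ))
    (f' := fun θ ↦ (k + 1 + s) * (logWeight 0 s θ * (Real.cos (((k + 1 : ℕ) : ℤ) * θ) : ℂ)) -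
      (k - s) * (logWeight 0 s θ * (Real.cos (((k : ℕ) : ℤ) * θ) : ℂ))) ?_ ?_
    ((hI1.const_mul _).sub (hI0.const_mul _))
  · rw [intervalIntegral.integral_sub (hI1.const_mul _) (hI0.const_mul _),
      intervalIntegral.integral_const_mul, intervalIntegral.integral_const_mul] at key
    have h1 : Real.sin ((k + 1) * Real.pi) = 0 := by exact_mod_cast Real.sin_nat_mul_pi (k + 1)
    rw [h1, Real.sin_nat_mul_pi] at key
    simpa [sub_eq_zero, cosMoment] using key
  · intro θ hθ
    rcases eq_or_lt_of_le hθ.1 with h0 | h0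
    · subst h0
      refine ContinuousAt.continuousWithinAt ?_
      rw [ContinuousAt]
      simp only [mul_zero, Real.sin_zero, sub_self, Complex.ofReal_zero]
      refine squeeze_zero_norm (norm_logWeight_mul_sin_sub_sin_le k s) ?_
      have hc : ContinuousAt (fun θ : ℝ ↦ √2 * (1 - Real.cos θ) ^ (s.re + 1 / 2)) 0 :=
        continuousAt_const.mul (ContinuousAt.rpow_const (by fun_prop) (Or.inr (by linarith)))
      simpa [ContinuousAt, Real.zero_rpow (show s.re + 2⁻¹ ≠ 0 by linarith)] using hc
    · exact (hasDerivAt_logWeight_mul_sin_sub_sin k s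
        ⟨h0, hθ.2⟩).continuousAt.continuousWithinAt
  · intro θ hθ
    exact hasDerivAt_logWeight_mul_sin_sub_sin k s ⟨hθ.1, hθ.2.le⟩

/-- The substitution `x = (1 - cos θ)/2` yields the Beta integral `B(s + 1/2, 1/2)`. -/
lemma cosMoment_zero_zero {s : ℂ} (hs : -(1 / 2 : ℝ) < s.re) :
    cosMoment 0 0 s =
      2 ^ s * (Complex.Gamma (s + 1 / 2) * Complex.Gamma (1 / 2) / Complex.Gamma (s + 1)) := by
  have hβ := Complex.betaIntegral_eq_Gamma_mul_div (s + 1 / 2) (1 / 2)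
    (by simp; linarith) (by norm_num)
  have hadd : s + 1 / 2 + 1 / 2 = s + 1 := by ring
  rw [hadd] at hβ
  rw [← hβ, Complex.betaIntegral, cosMoment]
  have hsub := intervalIntegral.integral_deriv_smul_comp_of_deriv_nonneg
    (a := 0) (b := Real.pi) (f := fun θ ↦ (1 - Real.cos θ) / 2) (f' := fun θ ↦ Real.sin θ / 2)
    (g := fun x : ℝ ↦ (x : ℂ) ^ (s + 1 / 2 - 1) * (1 - (x : ℂ)) ^ ((1 / 2 : ℂ) - 1))
    (by fun_prop) (fun θ _ ↦ by simpa using ((Real.hasDerivAt_cos θ).const_sub 1).div_const 2)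
    (fun θ hθ ↦ by
      rw [min_eq_left Real.pi_pos.le, max_eq_right Real.pi_pos.le] at hθ
      have := Real.sin_pos_of_mem_Ioo hθ
      positivity)
  norm_num at hsub
  norm_num
  rw [← hsub, ← intervalIntegral.integral_const_mul]
  refine intervalIntegral.integral_congr_Ioo_of_le (by positivity) fun θ hθ ↦ ?_
  have hs : 0 < Real.sin θ := Real.sin_pos_of_mem_Ioo hθ
  have h0 := (one_sub_cos_mem_Ioc ⟨hθ.1, hθ.2.le⟩).1
  set x : ℝ := (1 - Real.cos θ) / 2 with hx
  have hx0 : 0 < x := by positivity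
  have hprod : x * (1 - x) = (Real.sin θ / 2) ^ 2 := by
    rw [hx]; linear_combination -(Real.sin_sq_add_cos_sq θ) / 4
  have hx1 : 0 < 1 - x := pos_of_mul_pos_right (a := x) (by rw [hprod]; positivity) hx0.le
  have hxC : (x : ℂ) ≠ 0 := Complex.ofReal_ne_zero.mpr hx0.ne'
  have hx1C : ((1 - x : ℝ) : ℂ) ≠ 0 := Complex.ofReal_ne_zero.mpr hx1.ne'
  have hsin : ((Real.sin θ / 2 : ℝ) : ℂ) =
      (x : ℂ) ^ (1 / 2 : ℂ) * ((1 - x : ℝ) : ℂ) ^ (1 / 2 : ℂ) := by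
    rw [← Complex.mul_cpow_ofReal_nonneg hx0.le hx1.le, ← Complex.ofReal_mul, hprod,
      show (1 / 2 : ℂ) = ((1 / 2 : ℝ) : ℂ) by push_cast; rfl, ← Complex.ofReal_cpow (by positivity),
      ← Real.sqrt_eq_rpow, Real.sqrt_sq (by positivity)]
  have e1 : (x : ℂ) ^ (1 / 2 : ℂ) * (x : ℂ) ^ (s + 1 / 2 - 1) = (x : ℂ) ^ s := by
    rw [← Complex.cpow_add _ _ hxC]
    congr 1; ring
  have e2 : ((1 - x : ℝ) : ℂ) ^ (1 / 2 : ℂ) * ((1 - x : ℝ) : ℂ) ^ (-(1 / 2) : ℂ) = 1 := by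
    rw [← Complex.cpow_add _ _ hx1C, add_neg_cancel, Complex.cpow_zero]
  have e3 : (2 : ℂ) ^ s * (x : ℂ) ^ s = logWeight 0 s θ := by
    rw [logWeight, pow_zero, mul_one, show (2 : ℂ) = ((2 : ℝ) : ℂ) by push_cast; rfl,
      ← Complex.mul_cpow_ofReal_nonneg (by norm_num) hx0.le, ← Complex.ofReal_mul]
    congr 2
    rw [hx]; ring
  have c1 : Complex.sin θ / 2 = ((Real.sin θ / 2 : ℝ) : ℂ) := by push_cast; rfl
  have c2 : (1 - Complex.cos θ) / 2 = (x : ℂ) := by rw [hx]; push_cast; rfl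
  have c3 : 1 - (x : ℂ) = ((1 - x : ℝ) : ℂ) := by push_cast; rfl
  rw [c1, c2, c3, hsin]
  linear_combination -e3 - 2 ^ s * e1 -
    2 ^ s * (x : ℂ) ^ (1 / 2 : ℂ) * (x : ℂ) ^ (s + 1 / 2 - 1) * e2

/-! ### Rate of convergence of the normalized moments -/

/-- A discrete Grönwall argument: `C/k²` is dominated by the telescoping `2C(1/k - 1/(k+1))`, so the
sequence stays below `B e^(2C)` and its tail increments sum to `O(1/k)`. The constant depends only
on `B` and `C`, which later gives uniformity in `s`. -/
lemma norm_sub_limit_le_of_norm_succ_sub_le {z : ℕ → ℂ} {L : ℂ} {C B : ℝ} {N : ℕ} (hN : 1 ≤ N)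
    (hC : 0 ≤ C) (h : ∀ k ≥ N, ‖z (k + 1) - z k‖ ≤ C / (k : ℝ) ^ 2 * ‖z k‖) (hB : ‖z N‖ ≤ B)
    (hL : Tendsto z atTop (nhds L)) {k : ℕ} (hk : N ≤ k) :
    ‖z k - L‖ ≤ 2 * C * (B * Real.exp (2 * C)) / k := by
  have hB0 : 0 ≤ B := (norm_nonneg _).trans hB
  have htel : ∀ k : ℕ, N ≤ k →
      C / (k : ℝ) ^ 2 ≤ 2 * C * (1 / (k : ℝ) - 1 / ((k + 1 : ℕ) : ℝ)) := by
    intro k hk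
    have hk1 : (1 : ℝ) ≤ k := by exact_mod_cast hN.trans hk
    have : 1 / (k : ℝ) ^ 2 ≤ 2 * (1 / (k : ℝ) - 1 / ((k + 1 : ℕ) : ℝ)) := by
      push_cast
      have e : 2 * (1 / (k : ℝ) - 1 / (k + 1)) = 2 / (k * (k + 1)) := by field_simp; ring
      rw [e, div_le_div_iff₀ (by positivity) (by positivity)]
      nlinarith
    calc C / (k : ℝ) ^ 2 = C * (1 / (k : ℝ) ^ 2) := by ring
      _ ≤ C * (2 * (1 / (k : ℝ) - 1 / ((k + 1 : ℕ) : ℝ))) := by gcongr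
      _ = _ := by ring
  have hbd : ∀ k ≥ N, ‖z k‖ ≤ B * Real.exp (2 * C * (1 / (N : ℝ) - 1 / (k : ℝ))) := by
    intro k hk
    induction k, hk using Nat.le_induction with
    | base => simpa using hB
    | succ k hk ih =>
      calc ‖z (k + 1)‖ ≤ ‖z k‖ + ‖z (k + 1) - z k‖ := norm_le_norm_add_norm_sub' _ _
        _ ≤ ‖z k‖ * (1 + C / (k : ℝ) ^ 2) := by linarith [h k hk]
        _ ≤ (B * Real.exp (2 * C * (1 / (N : ℝ) - 1 / (k : ℝ)))) *
            Real.exp (2 * C * (1 / (k : ℝ) - 1 / ((k + 1 : ℕ) : ℝ))) := by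
          gcongr
          rw [add_comm]
          exact (Real.add_one_le_exp _).trans (Real.exp_le_exp.mpr (htel k hk))
        _ = _ := by rw [mul_assoc, ← Real.exp_add]; congr 2; ring
  have hbd' : ∀ k ≥ N, ‖z k‖ ≤ B * Real.exp (2 * C) := by
    intro k hk
    refine (hbd k hk).trans (mul_le_mul_of_nonneg_left (Real.exp_le_exp.mpr ?_) hB0)
    have h1 : 1 / (N : ℝ) ≤ 1 := by
      rw [div_le_one (by exact_mod_cast hN)]; exact_mod_cast hN
    have h2 : 0 ≤ 1 / (k : ℝ) := by positivity
    nlinarith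
  set D := B * Real.exp (2 * C) with hD
  have hD0 : 0 ≤ D := by positivity
  have hcauchy : ∀ m ≥ k, ‖z k - z m‖ ≤ 2 * C * D * (1 / (k : ℝ) - 1 / (m : ℝ)) := by
    intro m hm
    induction m, hm using Nat.le_induction with
    | base => simp
    | succ m hm ih =>
      calc ‖z k - z (m + 1)‖ ≤ ‖z k - z m‖ + ‖z m - z (m + 1)‖ := norm_sub_le_norm_sub_add_norm_sub _ _ _
        _ ≤ 2 * C * D * (1 / (k : ℝ) - 1 / (m : ℝ)) +
            2 * C * (1 / (m : ℝ) - 1 / ((m + 1 : ℕ) : ℝ)) * D := by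
          gcongr
          rw [norm_sub_rev]
          exact (h m (hk.trans hm)).trans (mul_le_mul (htel m (hk.trans hm))
            (hbd' m (hk.trans hm)) (norm_nonneg _)
            (le_trans (by positivity) (htel m (hk.trans hm))))
        _ = _ := by ring
  refine le_of_tendsto (hL.const_sub (z k)).norm ?_
  filter_upwards [eventually_ge_atTop k] with m hm
  refine (hcauchy m hm).trans ?_
  rw [show 2 * C * D / (k : ℝ) = 2 * C * D * (1 / k) by ring]
  refine mul_le_mul_of_nonneg_left ?_ (by positivity)
  have : 0 ≤ 1 / (m : ℝ) := by positivity
  linarith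

lemma norm_natCast_add_one_add_ge {s : ℂ} (hs : -(1 / 2 : ℝ) < s.re) (k : ℕ) :
    (k : ℝ) + 1 / 2 ≤ ‖(k : ℂ) + 1 + s‖ := by
  refine le_trans ?_ (Complex.re_le_norm _)
  simp
  linarith

lemma natCast_add_one_add_ne_zero {s : ℂ} (hs : -(1 / 2 : ℝ) < s.re) (k : ℕ) :
    (k : ℂ) + 1 + s ≠ 0 := by
  have := norm_natCast_add_one_add_ge hs k
  have : 0 < ‖(k : ℂ) + 1 + s‖ := lt_of_lt_of_le (by positivity) this
  exact norm_pos_iff.mp this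

/-- With `u = 2s + 1` the quantity is `(1 - u/(k+1+s))(1 + 1/k)^u - 1`. The first-order terms `∓u/k`
cancel, which is why `2s + 1` is the right normalizing exponent. -/
lemma norm_ratio_sub_one_le {s : ℂ} {R : ℝ} (hs : -(1 / 2 : ℝ) < s.re) (hR : ‖2 * s + 1‖ ≤ R)
    {k : ℕ} (hk : 1 ≤ k) (hRk : R ≤ k) :
    ‖((k : ℂ) - s) / (k + 1 + s) * (((k + 1 : ℕ) : ℂ) ^ (2 * s + 1) / (k : ℂ) ^ (2 * s + 1)) - 1‖ ≤
      ((R ^ 2 + R) + R * (1 + R) + R * (R ^ 2 + 2 * R)) / (k : ℝ) ^ 2 := by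
  have hR0 : 0 ≤ R := (norm_nonneg _).trans hR
  have hk1 : (1 : ℝ) ≤ k := by exact_mod_cast hk
  have hk0 : (0 : ℝ) < k := by linarith
  have hkC : (k : ℂ) ≠ 0 := by exact_mod_cast hk0.ne'
  have hden := norm_natCast_add_one_add_ge hs k
  have hdenk : (k : ℝ) ≤ ‖(k : ℂ) + 1 + s‖ := by linarith
  have hden0 := natCast_add_one_add_ne_zero hs k
  set u : ℂ := 2 * s + 1 with hu
  set l : ℝ := Real.log (1 + 1 / k) with hl
  set t : ℝ := 1 / k with ht
  have ht0 : 0 < t := by positivity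
  have hl1 : l ≤ t := by
    have := Real.log_le_sub_one_of_pos (show 0 < 1 + t by linarith)
    linarith
  have hl2 : t - t ^ 2 ≤ l := by
    have h1 := Real.one_sub_inv_le_log_of_pos (show 0 < 1 + t by linarith)
    have h2 : t - t ^ 2 ≤ 1 - (1 + t)⁻¹ := by
      rw [← sub_nonneg]
      have : 1 - (1 + t)⁻¹ - (t - t ^ 2) = t ^ 3 / (1 + t) := by field_simp; ring
      rw [this]; positivity
    linarith
  have hl0 : 0 ≤ l := Real.log_nonneg (by linarith)
  have hE : ((k + 1 : ℕ) : ℂ) ^ u / (k : ℂ) ^ u = Complex.exp (u * l) := by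
    have hlog : (l : ℂ) = Complex.log ((k + 1 : ℕ) : ℂ) - Complex.log (k : ℂ) := by
      rw [← Complex.natCast_log, ← Complex.natCast_log, ← Complex.ofReal_sub,
        ← Real.log_div (by positivity) hk0.ne', hl, ht]
      congr 2
      push_cast
      field_simp
    rw [Complex.cpow_def_of_ne_zero (by exact_mod_cast (Nat.succ_ne_zero k)),
      Complex.cpow_def_of_ne_zero hkC, ← Complex.exp_sub, hlog]
    congr 1; ring
  rw [hE]
  set a : ℂ := u / (k + 1 + s) with ha
  set b : ℂ := Complex.exp (u * l) - 1 with hb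
  have hfrac : ((k : ℂ) - s) / (k + 1 + s) = 1 - a := by
    rw [ha, hu]; field_simp; ring
  have hul : ‖u * (l : ℂ)‖ ≤ R * t := by
    rw [norm_mul, Complex.norm_real, Real.norm_eq_abs, abs_of_nonneg hl0]
    gcongr
  have hRt : R * t ≤ 1 := by rw [ht, mul_one_div, div_le_one hk0]; exact hRk
  have hb1 : ‖b - u * t‖ ≤ (R ^ 2 + R) * t ^ 2 := by
    have h1 := Complex.norm_exp_sub_one_sub_id_le (hul.trans hRt)
    have h2 : ‖u * (l : ℂ)‖ ^ 2 ≤ (R * t) ^ 2 := by gcongr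
    have h3 : ‖u * ((l - t : ℝ) : ℂ)‖ ≤ R * t ^ 2 := by
      rw [norm_mul, Complex.norm_real, Real.norm_eq_abs]
      gcongr
      rw [abs_le]; constructor <;> linarith
    calc ‖b - u * t‖ = ‖(Complex.exp (u * l) - 1 - u * l) + u * ((l - t : ℝ) : ℂ)‖ := by
          rw [hb]; congr 1; push_cast; ring
      _ ≤ _ := norm_add_le _ _
      _ ≤ (R * t) ^ 2 + R * t ^ 2 := add_le_add (h1.trans h2) h3
      _ = _ := by ring
  have ha0 : ‖a‖ ≤ R * t := by
    rw [ha, norm_div, ht, mul_one_div]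
    gcongr
  have ha1 : ‖a - u * t‖ ≤ R * (1 + R) * t ^ 2 := by
    have e : a - u * t = -(a * (1 + s) * t) := by
      rw [ha, ht]; push_cast; field_simp; ring
    have hs1 : ‖1 + s‖ ≤ 1 + R := by
      have : 1 + s = (u + 1) / 2 := by rw [hu]; ring
      rw [this, norm_div]
      have := norm_add_le u 1
      rw [norm_one] at this
      rw [Complex.norm_ofNat]
      linarith
    rw [e, norm_neg, norm_mul, norm_mul, Complex.norm_real, Real.norm_eq_abs, abs_of_pos ht0]
    calc ‖a‖ * ‖1 + s‖ * t ≤ (R * t) * (1 + R) * t := by gcongr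
      _ = _ := by ring
  have ht1 : t ≤ 1 := by rw [ht, div_le_one hk0]; exact hk1
  have hb0 : ‖b‖ ≤ (R ^ 2 + 2 * R) * t := by
    have h1 : ‖b‖ ≤ ‖b - u * t‖ + ‖u * t‖ := by simpa using norm_add_le (b - u * t) (u * t)
    have h2 : ‖u * (t : ℂ)‖ ≤ R * t := by
      rw [norm_mul, Complex.norm_real, Real.norm_eq_abs, abs_of_pos ht0]; gcongr
    have h3 : (R ^ 2 + R) * t ^ 2 ≤ (R ^ 2 + R) * t := by
      gcongr; nlinarith
    linarith
  -- Here `(1 - a)(1 + b) - 1 = b - a - ab`; inserting the common first-order part `u t` leaves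
  -- three quantities of order `t²`.
  calc _ = ‖((b - u * t) - (a - u * t)) - a * b‖ := by rw [hfrac, hb]; congr 1; ring
    _ ≤ ‖b - u * t‖ + ‖a - u * t‖ + ‖a * b‖ :=
      (norm_sub_le _ _).trans (add_le_add_left (norm_sub_le _ _) _)
    _ ≤ (R ^ 2 + R) * t ^ 2 + R * (1 + R) * t ^ 2 + (R * t) * ((R ^ 2 + 2 * R) * t) := by
      rw [norm_mul]; gcongr
    _ = _ := by rw [ht]; field_simp

/-! ### Identification of the limit and uniformity in the exponent -/

/-- The limit of `k ^ (2 * s + 1) * cosMoment 0 k s`. -/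
noncomputable def cosMomentLimit (s : ℂ) : ℂ :=
  -(2 ^ (-s) * Complex.Gamma (2 * s + 1) * Complex.sin (Real.pi * s))

lemma cosMoment_eq_prod (k : ℕ) {s : ℂ} (hs : -(1 / 2 : ℝ) < s.re) :
    cosMoment 0 k s =
      cosMoment 0 0 s * ∏ j ∈ Finset.range k, (((j : ℂ) - s) / (j + 1 + s)) := by
  induction k with
  | zero => simp
  | succ k ih =>
    rw [Finset.prod_range_succ, ← mul_assoc, ← ih]
    have := cosMoment_succ k hs
    have h0 := natCast_add_one_add_ne_zero hs k
    field_simp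
    linear_combination this

/-- The reflection formula replaces `1/Γ(-s)` by `-Γ(1+s) sin(πs)/π`, and the duplication formula
merges `Γ(s + 1/2) Γ(s + 1)` into `Γ(2s + 1)`. Nonnegative integers are excluded because `-s` is
then a pole of `Γ`. -/
lemma cosMomentLimit_eq_of_ne_nat {s : ℂ} (hs : -(1 / 2 : ℝ) < s.re) (hn : ∀ n : ℕ, s ≠ n) :
    cosMoment 0 0 s * (Complex.Gamma (1 + s) / Complex.Gamma (-s)) = cosMomentLimit s := by
  have hG1 : Complex.Gamma (1 + s) ≠ 0 :=
    Complex.Gamma_ne_zero_of_re_pos (by simp; linarith)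
  have hG2 : Complex.Gamma (-s) ≠ 0 := Complex.Gamma_ne_zero fun m h ↦ hn m (by simpa using h)
  have hrefl := Complex.Gamma_mul_Gamma_one_sub (-s)
  rw [sub_neg_eq_add, mul_neg, Complex.sin_neg] at hrefl
  have hsin : Complex.sin (Real.pi * s) ≠ 0 := by
    intro h
    rw [h, neg_zero, div_zero] at hrefl
    exact mul_ne_zero hG2 hG1 hrefl
  have hdup := Complex.Gamma_mul_Gamma_add_half (s + 1 / 2)
  have e1 : s + 1 / 2 + 1 / 2 = 1 + s := by ring
  have e2 : 2 * (s + 1 / 2) = 2 * s + 1 := by ring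
  have e3 : (1 : ℂ) - (2 * s + 1) = -s + -s := by ring
  rw [e1, e2, e3, Complex.cpow_add _ _ two_ne_zero] at hdup
  have hpi : (Complex.Gamma (1 / 2)) * (√Real.pi : ℂ) = Real.pi := by
    rw [show (1 / 2 : ℂ) = ((1 / 2 : ℝ) : ℂ) by push_cast; rfl, Complex.Gamma_ofReal,
      Real.Gamma_one_half_eq, ← Complex.ofReal_mul, Real.mul_self_sqrt Real.pi_pos.le]
  have hpi0 : (Real.pi : ℂ) ≠ 0 := by exact_mod_cast Real.pi_ne_zero
  have h2 : (2 : ℂ) ^ s * 2 ^ (-s) = 1 := by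
    rw [← Complex.cpow_add _ _ two_ne_zero, add_neg_cancel, Complex.cpow_zero]
  rw [cosMoment_zero_zero hs, cosMomentLimit, add_comm s 1]
  rw [eq_div_iff (neg_ne_zero.mpr hsin)] at hrefl
  have hinv : (Complex.Gamma (-s))⁻¹ =
      -(Complex.Gamma (1 + s) * Complex.sin (Real.pi * s)) / Real.pi := by
    rw [eq_div_iff hpi0, inv_mul_eq_iff_eq_mul₀ hG2]
    linear_combination -hrefl
  rw [div_eq_mul_inv _ (Complex.Gamma (-s)), hinv]
  generalize Complex.Gamma (s + 1 / 2) = A at *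
  generalize Complex.Gamma (1 / 2) = P at *
  generalize Complex.Gamma (2 * s + 1) = D at *
  generalize Complex.Gamma (1 + s) = G at *
  generalize Complex.sin (Real.pi * s) = S at *
  generalize (2 : ℂ) ^ (-s) = q at *
  generalize (2 : ℂ) ^ s = p at *
  field_simp
  linear_combination -(p * P) * hdup - (p * q * q * D) * hpi - (Real.pi * q * D) * h2

lemma tendsto_cosMoment_mul_cpow {s : ℂ} (hs : -(1 / 2 : ℝ) < s.re) :
    Tendsto (fun k : ℕ ↦ cosMoment 0 k s * (k : ℂ) ^ (2 * s + 1)) atTop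
      (nhds (cosMomentLimit s)) := by
  -- At `s = n` the product has a zero factor once `k > n`, and the sine in the limit vanishes too.
  -- Otherwise the product is a quotient of Euler's sequences for `Γ(1+s)` and `Γ(-s)`, up to their
  -- extra last factors, whose ratio tends to `1`.
  by_cases hn : ∃ n : ℕ, s = n
  · obtain ⟨n, rfl⟩ := hn
    have hlim : cosMomentLimit (n : ℂ) = 0 := by
      rw [cosMomentLimit, mul_comm (Real.pi : ℂ), Complex.sin_nat_mul_pi, mul_zero, neg_zero]
    rw [hlim]
    refine tendsto_const_nhds.congr' ?_
    filter_upwards [eventually_gt_atTop n] with k hk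
    rw [cosMoment_eq_prod k hs, Finset.prod_eq_zero (Finset.mem_range.mpr hk) (by simp)]
    simp
  · push Not at hn
    have hG2 : Complex.Gamma (-s) ≠ 0 := Complex.Gamma_ne_zero fun m h ↦ hn m (by simpa using h)
    have hlim := (((Complex.GammaSeq_tendsto_Gamma (1 + s)).div
      (Complex.GammaSeq_tendsto_Gamma (-s)) hG2).const_mul (cosMoment 0 0 s)).mul
      (((tendsto_natCast_div_add_atTop (-s)).div (tendsto_natCast_div_add_atTop (1 + s))
        one_ne_zero))
    rw [cosMomentLimit_eq_of_ne_nat hs hn, div_one, mul_one] at hlim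
    refine hlim.congr' ?_
    filter_upwards [eventually_ge_atTop 1] with k hk
    have hkC : (k : ℂ) ≠ 0 := by exact_mod_cast (by omega : k ≠ 0)
    have hks : (k : ℂ) - s ≠ 0 := sub_ne_zero.mpr (hn k).symm
    have hks1 := natCast_add_one_add_ne_zero hs k
    have hfac : ((k.factorial : ℕ) : ℂ) ≠ 0 := by exact_mod_cast k.factorial_ne_zero
    have hp1 : ∏ j ∈ Finset.range k, ((j : ℂ) + 1 + s) ≠ 0 :=
      Finset.prod_ne_zero_iff.mpr fun j _ ↦ natCast_add_one_add_ne_zero hs j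
    have hp2 : ∏ j ∈ Finset.range k, ((j : ℂ) - s) ≠ 0 :=
      Finset.prod_ne_zero_iff.mpr fun j _ ↦ sub_ne_zero.mpr (hn j).symm
    have hpow : (k : ℂ) ^ (2 * s + 1) * (k : ℂ) ^ (-s) = (k : ℂ) ^ (1 + s) := by
      rw [← Complex.cpow_add _ _ hkC]; congr 1; ring
    have hpk : (k : ℂ) ^ (-s) ≠ 0 := by simp [Complex.cpow_eq_zero_iff, hkC]
    have q1 : ∏ j ∈ Finset.range (k + 1), (1 + s + (j : ℂ)) =
        (∏ j ∈ Finset.range k, ((j : ℂ) + 1 + s)) * (k + 1 + s) := by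
      rw [Finset.prod_range_succ]
      congr 1
      · exact Finset.prod_congr rfl fun j _ ↦ by ring
      · ring
    have q2 : ∏ j ∈ Finset.range (k + 1), (-s + (j : ℂ)) =
        (∏ j ∈ Finset.range k, ((j : ℂ) - s)) * (k - s) := by
      rw [Finset.prod_range_succ]
      congr 1
      · exact Finset.prod_congr rfl fun j _ ↦ by ring
      · ring
    simp only [Pi.div_apply]
    rw [cosMoment_eq_prod k hs, Complex.GammaSeq, Complex.GammaSeq, q1, q2, Finset.prod_div_distrib,
      ← hpow]
    have hks1' : (k : ℂ) + (1 + s) ≠ 0 := by convert hks1 using 1; ring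
    have hks' : (k : ℂ) + -s ≠ 0 := by rwa [← sub_eq_add_neg]
    field_simp
    ring

/-- Uniform asymptotics of the moments with exponent near `γ`. -/
theorem exists_norm_cosMoment_mul_cpow_sub_le {γ : ℝ} (hγ : -(1 / 2 : ℝ) < γ) :
    ∃ r > 0, ∃ C : ℝ, ∃ N : ℕ, 0 ≤ C ∧ 1 ≤ N ∧ ∀ s ∈ Metric.closedBall (γ : ℂ) r,
      -(1 / 2 : ℝ) < s.re ∧
      ∀ k : ℕ, N ≤ k → ‖cosMoment 0 k s * (k : ℂ) ^ (2 * s + 1) - cosMomentLimit s‖ ≤ C / k := by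
  set r : ℝ := (γ + 1 / 2) / 2 with hr
  have hr0 : 0 < r := by linarith
  have hre : ∀ s ∈ Metric.closedBall (γ : ℂ) r, -(1 / 2 : ℝ) < s.re := by
    intro s hs
    have h := (Complex.abs_re_le_norm (s - γ)).trans (mem_closedBall_iff_norm.mp hs)
    rw [Complex.sub_re, Complex.ofReal_re, abs_le] at h
    linarith
  set R : ℝ := 2 * (|γ| + r) + 1 with hR
  have hnorm : ∀ s ∈ Metric.closedBall (γ : ℂ) r, ‖2 * s + 1‖ ≤ R := by
    intro s hs
    have h := mem_closedBall_iff_norm.mp hs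
    have h1 : ‖s‖ ≤ |γ| + r := by
      have := norm_le_norm_add_norm_sub' s (γ : ℂ)
      rw [Complex.norm_real, Real.norm_eq_abs] at this
      linarith
    calc ‖2 * s + 1‖ ≤ ‖2 * s‖ + ‖(1 : ℂ)‖ := norm_add_le _ _
      _ = 2 * ‖s‖ + 1 := by simp
      _ ≤ R := by linarith
  have hR0 : 0 ≤ R := by positivity
  -- From this index on `R ≤ k`, as the ratio estimate needs. The starting value at `N` is bounded
  -- on the whole disc by compactness.
  set N : ℕ := ⌈R⌉₊ + 1 with hN
  have hN1 : 1 ≤ N := by omega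
  have hNR : R ≤ N := by
    rw [hN]; push_cast; linarith [Nat.le_ceil R]
  have hNC : ((N : ℕ) : ℂ) ≠ 0 := by exact_mod_cast (by omega : N ≠ 0)
  have hcont : ContinuousOn (fun s ↦ cosMoment 0 N s * (N : ℂ) ^ (2 * s + 1))
      (Metric.closedBall (γ : ℂ) r) := by
    refine ContinuousOn.mul ((differentiableOn_cosMoment 0 N).continuousOn.mono hre) ?_
    exact ContinuousOn.const_cpow (by fun_prop) (Or.inl hNC)
  obtain ⟨B, hB⟩ := (isCompact_closedBall (γ : ℂ) r).exists_bound_of_continuousOn hcont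
  have hB0 : 0 ≤ B := (norm_nonneg _).trans (hB γ (Metric.mem_closedBall_self hr0.le))
  set C : ℝ := (R ^ 2 + R) + R * (1 + R) + R * (R ^ 2 + 2 * R) with hC
  have hC0 : 0 ≤ C := by positivity
  refine ⟨r, hr0, 2 * C * (B * Real.exp (2 * C)), N, by positivity, hN1,
    fun s hs ↦ ⟨hre s hs, fun k hk ↦ ?_⟩⟩
  refine norm_sub_limit_le_of_norm_succ_sub_le
    (z := fun k : ℕ ↦ cosMoment 0 k s * (k : ℂ) ^ (2 * s + 1)) hN1 hC0 ?_ (hB s hs)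
    (tendsto_cosMoment_mul_cpow (hre s hs)) hk
  intro j hj
  have hj1 : 1 ≤ j := hN1.trans hj
  have hjC : (j : ℂ) ≠ 0 := by exact_mod_cast (by omega : j ≠ 0)
  have hpj : (j : ℂ) ^ (2 * s + 1) ≠ 0 := by simp [Complex.cpow_eq_zero_iff, hjC]
  have hratio := norm_ratio_sub_one_le (hre s hs) (hnorm s hs) hj1
    (hNR.trans (by exact_mod_cast hj))
  have hsucc := cosMoment_succ j (hre s hs)
  have h0 := natCast_add_one_add_ne_zero (hre s hs) j
  have e : cosMoment 0 (j + 1 : ℕ) s * ((j + 1 : ℕ) : ℂ) ^ (2 * s + 1) -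
      cosMoment 0 j s * (j : ℂ) ^ (2 * s + 1) =
      (((j : ℂ) - s) / (j + 1 + s) * (((j + 1 : ℕ) : ℂ) ^ (2 * s + 1) / (j : ℂ) ^ (2 * s + 1)) - 1) *
        (cosMoment 0 j s * (j : ℂ) ^ (2 * s + 1)) := by
    have : cosMoment 0 (j + 1 : ℕ) s = ((j : ℂ) - s) * cosMoment 0 j s / (j + 1 + s) := by
      rw [eq_div_iff h0]; linear_combination hsucc
    rw [this]
    generalize (j : ℂ) ^ (2 * s + 1) = p at *
    field_simp
  rw [e, norm_mul]
  gcongr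

/-! ### Cauchy estimates and asymptotics of the logarithmic moments -/

/-- Within distance `1/log k` of `γ` the modulus of `k^(-2s-1)` exceeds its value at `γ` by at most
a factor `e²`, while Cauchy's estimate on that circle costs `log^n k`. -/
lemma norm_iteratedDeriv_le_of_norm_mul_cpow_le {F : ℂ → ℂ} {U : Set ℂ} {γ B : ℝ} {k : ℕ} (n : ℕ)
    (hk : 0 < Real.log k) (hF : DifferentiableOn ℂ F U)
    (hU : Metric.closedBall (γ : ℂ) (1 / Real.log k) ⊆ U)
    (hB : ∀ s ∈ Metric.sphere (γ : ℂ) (1 / Real.log k), ‖F s * (k : ℂ) ^ (2 * s + 1)‖ ≤ B) :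
    ‖iteratedDeriv n F γ‖ ≤
      n.factorial * (Real.exp 2 * B) * (Real.log k ^ n * (k : ℝ) ^ (-(2 * γ + 1))) := by
  have hk0 : (0 : ℝ) < k := by
    rcases Nat.eq_zero_or_pos k with rfl | h
    · simp at hk
    · exact_mod_cast h
  have hbound : ∀ s ∈ Metric.sphere (γ : ℂ) (1 / Real.log k),
      ‖F s‖ ≤ Real.exp 2 * B * (k : ℝ) ^ (-(2 * γ + 1)) := by
    intro s hs
    have h := hB s hs
    have hB0 : 0 ≤ B := (norm_nonneg _).trans h
    have hre : γ - 1 / Real.log k ≤ s.re := by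
      have h := (Complex.abs_re_le_norm (s - γ)).trans_eq (mem_sphere_iff_norm.mp hs)
      rw [Complex.sub_re, Complex.ofReal_re, abs_le] at h
      linarith
    rw [norm_mul, ← Complex.ofReal_natCast, Complex.norm_cpow_eq_rpow_re_of_pos hk0] at h
    have hre2 : (2 * s + 1).re = 2 * s.re + 1 := by simp
    rw [hre2, ← le_div_iff₀ (by positivity), div_eq_mul_inv, ← Real.rpow_neg hk0.le] at h
    refine h.trans ?_
    have hp : (k : ℝ) ^ (-(2 * s.re + 1)) ≤ Real.exp 2 * (k : ℝ) ^ (-(2 * γ + 1)) := by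
      rw [Real.rpow_def_of_pos hk0, Real.rpow_def_of_pos hk0, ← Real.exp_add]
      refine Real.exp_le_exp.mpr ?_
      have : Real.log k * (γ - 1 / Real.log k) ≤ Real.log k * s.re := by gcongr
      have e : Real.log k * (γ - 1 / Real.log k) = Real.log k * γ - 1 := by field_simp
      linarith
    calc B * (k : ℝ) ^ (-(2 * s.re + 1)) ≤ B * (Real.exp 2 * (k : ℝ) ^ (-(2 * γ + 1))) := by gcongr
      _ = _ := by ring
  have := Complex.norm_iteratedDeriv_le_of_forall_mem_sphere_norm_le n (one_div_pos.mpr hk)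
    (hF.diffContOnCl_ball hU) hbound
  refine this.trans_eq ?_
  rw [one_div, inv_pow]
  field_simp

lemma iteratedDeriv_linear_mul_cexp (A B c d γ : ℂ) (n : ℕ) :
    iteratedDeriv n (fun s ↦ (A + B * (s - γ)) * Complex.exp (c * s + d)) =
      fun s ↦ (c ^ n * (A + B * (s - γ)) + n * B * c ^ (n - 1)) * Complex.exp (c * s + d) := by
  induction n with
  | zero => simp
  | succ n ih =>
    rw [iteratedDeriv_succ, ih]
    funext s
    have h1 : HasDerivAt (fun s ↦ c ^ n * (A + B * (s - γ)) + n * B * c ^ (n - 1)) (c ^ n * B) s := by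
      simpa using (((((hasDerivAt_id s).sub_const γ).const_mul B).const_add A).const_mul
        (c ^ n)).add_const (n * B * c ^ (n - 1))
    have h2 : HasDerivAt (fun s ↦ Complex.exp (c * s + d)) (Complex.exp (c * s + d) * c) s := by
      simpa using (((hasDerivAt_id s).const_mul c).add_const d).cexp
    rw [(h1.fun_mul h2).deriv]
    rcases n with _ | n
    · simp; ring
    · simp only [Nat.add_sub_cancel]
      push_cast
      ring

lemma differentiableOn_cosMomentLimit :
    DifferentiableOn ℂ cosMomentLimit {s : ℂ | -(1 / 2 : ℝ) < s.re} := by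
  intro s hs
  have hΓ : DifferentiableAt ℂ Complex.Gamma (2 * s + 1) := by
    refine Complex.differentiableAt_Gamma _ fun m h ↦ ?_
    have := congrArg Complex.re h
    simp at this
    have hs' : -(1 / 2 : ℝ) < s.re := hs
    have : (0 : ℝ) ≤ m := by positivity
    linarith
  have hΓ' : DifferentiableAt ℂ (fun s ↦ Complex.Gamma (2 * s + 1)) s :=
    DifferentiableAt.comp s hΓ (by fun_prop)
  have h2 : DifferentiableAt ℂ (fun s : ℂ ↦ (2 : ℂ) ^ (-s)) s :=
    DifferentiableAt.const_cpow (by fun_prop) (Or.inl two_ne_zero)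
  exact ((h2.mul hΓ').mul (by fun_prop)).neg.differentiableWithinAt

lemma AnalyticAt.isBigO_sub_linear {f : ℂ → ℂ} {x : ℂ} (hf : AnalyticAt ℂ f x) :
    (fun s ↦ f s - (f x + deriv f x * (s - x))) =O[nhds x] fun s ↦ ‖s - x‖ ^ 2 := by
  obtain ⟨p, hp⟩ := hf
  have h := hp.isBigO_sub_partialSum_pow 2
  have hsub : Tendsto (fun s : ℂ ↦ s - x) (nhds x) (nhds 0) := by
    simpa using (tendsto_id (α := ℂ) (x := nhds x)).sub_const x
  refine (h.comp_tendsto hsub).congr_left fun s ↦ ?_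
  have h0 : p.coeff 0 = f x := hp.coeff_zero _
  simp [FormalMultilinearSeries.partialSum, Finset.sum_range_succ, h0, hp.deriv]
  ring

lemma log_sq_le_four_mul (k : ℕ) : Real.log k ^ 2 ≤ 4 * k := by
  rcases Nat.eq_zero_or_pos k with rfl | h
  · simp
  have hk : (1 : ℝ) ≤ k := by exact_mod_cast h
  have h0 := Real.log_nonneg hk
  have h1 : Real.log k = 2 * Real.log √k := by rw [Real.log_sqrt (by linarith)]; ring
  have h2 : Real.log √k ≤ √k :=
    (Real.log_le_sub_one_of_pos (Real.sqrt_pos.mpr (by linarith))).trans (by linarith)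
  have h3 : √(k : ℝ) ^ 2 = k := Real.sq_sqrt (by linarith)
  have h4 : 0 ≤ Real.log √k := by linarith
  nlinarith

lemma contDiffAt_cosMoment_zero {γ : ℝ} (hγ : -(1 / 2 : ℝ) < γ) (n : ℤ) (m : WithTop ℕ∞) :
    ContDiffAt ℂ m (cosMoment 0 n) γ :=
  ((differentiableOn_cosMoment 0 n).analyticAt
    (isOpen_neg_half_lt_re.mem_nhds (by simpa using hγ))).contDiffAt

/-- Two-term asymptotics of the logarithmic cosine moments. -/
theorem exists_norm_cosMoment_sub_le {γ : ℝ} (hγ : -(1 / 2 : ℝ) < γ) (μ : ℕ) :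
    ∃ C : ℝ, ∃ N : ℕ, ∀ k : ℕ, N ≤ k →
      ‖cosMoment μ k γ - ((-2 * Real.log k : ℂ) ^ μ * cosMomentLimit γ +
        μ * deriv cosMomentLimit γ * (-2 * Real.log k : ℂ) ^ (μ - 1)) *
          (((k : ℝ) ^ (-(2 * γ + 1)) : ℝ) : ℂ)‖ ≤
      C * (Real.log k ^ ((μ : ℤ) - 2) * (k : ℝ) ^ (-(2 * γ + 1))) := by
  obtain ⟨r, hr, C₁, N, hC₁, hN, hunif⟩ := exists_norm_cosMoment_mul_cpow_sub_le hγ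
  have han : AnalyticAt ℂ cosMomentLimit γ := differentiableOn_cosMomentLimit.analyticAt
    (isOpen_neg_half_lt_re.mem_nhds (by simpa using hγ))
  obtain ⟨C₂, hC₂⟩ := han.isBigO_sub_linear.bound
  obtain ⟨ε, hε, hC₂⟩ := Metric.eventually_nhds_iff.mp hC₂
  have hlog : Tendsto (fun k : ℕ ↦ 1 / Real.log k) atTop (nhds 0) :=
    (Real.tendsto_log_atTop.comp tendsto_natCast_atTop_atTop).const_div_atTop 1
  obtain ⟨N', hN'⟩ := eventually_atTop.mp ((hlog.eventually_lt_const hε).and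
    (hlog.eventually_lt_const hr))
  refine ⟨μ.factorial * (Real.exp 2 * (4 * C₁ + C₂)), max (max N N') 2, fun k hk ↦ ?_⟩
  have hkN : N ≤ k := by omega
  have hk2 : 2 ≤ k := by omega
  obtain ⟨hkε, hkr⟩ := hN' k (by omega)
  have hk0 : (0 : ℝ) < k := by positivity
  have hkC : (k : ℂ) ≠ 0 := by exact_mod_cast hk0.ne'
  have hL : 0 < Real.log k := Real.log_pos (by exact_mod_cast hk2)
  set L := Real.log k with hLdef
  have hexp : ∀ s : ℂ, Complex.exp (-2 * L * s + -L) * (k : ℂ) ^ (2 * s + 1) = 1 := by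
    intro s
    rw [Complex.cpow_def_of_ne_zero hkC, ← Complex.natCast_log, ← Complex.exp_add]
    rw [← hLdef, show -2 * (L : ℂ) * s + -L + L * (2 * s + 1) = 0 by ring, Complex.exp_zero]
  -- The exponential is `k^(-2s-1)`, so each derivative of it produces a factor `-2 log k`.
  set e : ℂ → ℂ := fun s ↦ (cosMomentLimit γ + deriv cosMomentLimit γ * (s - γ)) *
    Complex.exp (-2 * L * s + -L) with he
  have heγ : Complex.exp (-2 * L * γ + -L) = (((k : ℝ) ^ (-(2 * γ + 1)) : ℝ) : ℂ) := by
    rw [Real.rpow_def_of_pos hk0, Complex.ofReal_exp, ← hLdef]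
    congr 1; push_cast; ring
  have hediff : Differentiable ℂ e := by rw [he]; fun_prop
  have hderiv : iteratedDeriv μ (fun s ↦ cosMoment 0 k s - e s) γ =
      cosMoment μ k γ - ((-2 * L : ℂ) ^ μ * cosMomentLimit γ +
        μ * deriv cosMomentLimit γ * (-2 * L : ℂ) ^ (μ - 1)) *
          (((k : ℝ) ^ (-(2 * γ + 1)) : ℝ) : ℂ) := by
    rw [iteratedDeriv_fun_sub (contDiffAt_cosMoment_zero hγ k μ) hediff.contDiff.contDiffAt,
      iteratedDeriv_cosMoment μ k (by simpa using hγ), he, iteratedDeriv_linear_mul_cexp]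
    simp only [sub_self, mul_zero, add_zero, heγ]
  rw [← hderiv]
  -- `C₂/L²` is the quadratic Taylor remainder on the circle; `4 C₁` comes from `1/k ≤ 4/L²`.
  refine (norm_iteratedDeriv_le_of_norm_mul_cpow_le (B := (4 * C₁ + C₂) / L ^ 2) μ hL
    (((differentiableOn_cosMoment 0 k).fun_sub hediff.differentiableOn)) (fun s hs ↦ ?_)
    fun s hs ↦ ?_).trans_eq ?_
  · exact (hunif s (Metric.closedBall_subset_closedBall hkr.le hs)).1
  · have hsr : s ∈ Metric.closedBall (γ : ℂ) r :=
      Metric.closedBall_subset_closedBall hkr.le (Metric.sphere_subset_closedBall hs)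
    have h1 := (hunif s hsr).2 k hkN
    have hdist : ‖s - γ‖ = 1 / L := mem_sphere_iff_norm.mp hs
    have h2 := hC₂ (y := s) (by rw [dist_eq_norm, hdist]; exact hkε)
    rw [hdist, Real.norm_of_nonneg (by positivity)] at h2
    have h3 : (cosMoment 0 k s - e s) * (k : ℂ) ^ (2 * s + 1) =
        (cosMoment 0 k s * (k : ℂ) ^ (2 * s + 1) - cosMomentLimit s) +
        (cosMomentLimit s - (cosMomentLimit γ + deriv cosMomentLimit γ * (s - γ))) := by
      rw [sub_mul, he]
      linear_combination -(cosMomentLimit γ + deriv cosMomentLimit γ * (s - γ)) * hexp s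
    rw [h3]
    refine (norm_add_le _ _).trans ((add_le_add h1 h2).trans ?_)
    have h4 : C₁ / k ≤ 4 * C₁ / L ^ 2 := by
      rw [div_le_div_iff₀ hk0 (by positivity)]
      nlinarith [log_sq_le_four_mul k]
    calc C₁ / k + C₂ * (1 / L) ^ 2 ≤ 4 * C₁ / L ^ 2 + C₂ * (1 / L) ^ 2 := by gcongr
      _ = _ := by field_simp
  · rw [← hLdef, zpow_sub₀ hL.ne', zpow_natCast]
    norm_cast
    field_simp

/-- The recurrence makes the difference `-(2s+1)/(k+1+s)` times a moment, which gains a full power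
of `k`. Half of it is spent on absorbing `log^μ k`, so the bound is a pure power. -/
lemma exists_norm_cosMoment_succ_sub_le {γ : ℝ} (hγ : -(1 / 2 : ℝ) < γ) (μ : ℕ) :
    ∃ C : ℝ, ∃ N : ℕ, ∀ k : ℕ, N ≤ k →
      ‖cosMoment μ (k + 1 : ℕ) γ - cosMoment μ k γ‖ ≤ C * (k : ℝ) ^ (-(2 * γ + 3 / 2)) := by
  obtain ⟨r, hr, C₁, N, hC₁, hN, hunif⟩ := exists_norm_cosMoment_mul_cpow_sub_le hγ
  have hcont : ContinuousOn (fun s : ℂ ↦ ‖2 * s + 1‖ * (C₁ + ‖cosMomentLimit s‖))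
      (Metric.closedBall (γ : ℂ) r) :=
    ContinuousOn.mul (by fun_prop) (continuousOn_const.add
      (differentiableOn_cosMomentLimit.continuousOn.mono fun s hs ↦ (hunif s hs).1).norm)
  obtain ⟨D, hD⟩ := (isCompact_closedBall (γ : ℂ) r).exists_bound_of_continuousOn hcont
  have hlog : Tendsto (fun k : ℕ ↦ 1 / Real.log k) atTop (nhds 0) :=
    (Real.tendsto_log_atTop.comp tendsto_natCast_atTop_atTop).const_div_atTop 1
  have hpow : (fun k : ℕ ↦ Real.log k ^ (μ : ℝ)) =O[atTop] fun k : ℕ ↦ (k : ℝ) ^ (1 / 2 : ℝ) :=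
    (isLittleO_log_rpow_rpow_atTop μ (by norm_num : (0 : ℝ) < 1 / 2)).isBigO.comp_tendsto
      tendsto_natCast_atTop_atTop
  obtain ⟨C₂, hC₂⟩ := hpow.bound
  obtain ⟨N', hN'⟩ := eventually_atTop.mp (hC₂.and (hlog.eventually_lt_const hr))
  refine ⟨μ.factorial * (Real.exp 2 * D) * C₂, max (max N N') 2, fun k hk ↦ ?_⟩
  have hkN : N ≤ k := by omega
  have hk2 : 2 ≤ k := by omega
  obtain ⟨hkC₂, hkr⟩ := hN' k (by omega)
  have hk0 : (0 : ℝ) < k := by positivity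
  have hk1 : (1 : ℝ) ≤ k := by exact_mod_cast (by omega : 1 ≤ k)
  have hL : 0 < Real.log k := Real.log_pos (by exact_mod_cast hk2)
  rw [Real.rpow_natCast, Real.norm_of_nonneg (by positivity),
    Real.norm_of_nonneg (by positivity)] at hkC₂
  have hD0 : 0 ≤ D := (norm_nonneg _).trans (hD γ (Metric.mem_closedBall_self hr.le))
  have hderiv : iteratedDeriv μ (fun s ↦ cosMoment 0 (k + 1 : ℕ) s - cosMoment 0 k s) γ =
      cosMoment μ (k + 1 : ℕ) γ - cosMoment μ k γ := by
    rw [iteratedDeriv_fun_sub (contDiffAt_cosMoment_zero hγ _ μ) (contDiffAt_cosMoment_zero hγ _ μ),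
      iteratedDeriv_cosMoment _ _ (by simpa using hγ),
      iteratedDeriv_cosMoment _ _ (by simpa using hγ)]
  rw [← hderiv]
  refine (norm_iteratedDeriv_le_of_norm_mul_cpow_le (B := D / k) μ hL
    (((differentiableOn_cosMoment 0 _).fun_sub (differentiableOn_cosMoment 0 _))) (fun s hs ↦ ?_)
    fun s hs ↦ ?_).trans ?_
  · exact (hunif s (Metric.closedBall_subset_closedBall hkr.le hs)).1
  · have hsr : s ∈ Metric.closedBall (γ : ℂ) r :=
      Metric.closedBall_subset_closedBall hkr.le (Metric.sphere_subset_closedBall hs)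
    have h1 := (hunif s hsr).2 k hkN
    have hs' := (hunif s hsr).1
    have h0 := natCast_add_one_add_ne_zero hs' k
    have hden := norm_natCast_add_one_add_ge hs' k
    have hM : cosMoment 0 (k + 1 : ℕ) s - cosMoment 0 k s =
        -((2 * s + 1) / (k + 1 + s)) * cosMoment 0 k s := by
      have := cosMoment_succ k hs'
      field_simp
      linear_combination this
    have hZ : ‖cosMoment 0 k s * (k : ℂ) ^ (2 * s + 1)‖ ≤ C₁ + ‖cosMomentLimit s‖ := by
      have h2 := norm_le_norm_add_norm_sub' (cosMoment 0 k s * (k : ℂ) ^ (2 * s + 1))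
        (cosMomentLimit s)
      have h3 : C₁ / k ≤ C₁ := div_le_self hC₁ hk1
      linarith
    rw [hM, mul_assoc, norm_mul, norm_neg, norm_div]
    have hDs := (le_abs_self _).trans (hD s hsr)
    calc ‖2 * s + 1‖ / ‖(k : ℂ) + 1 + s‖ * ‖cosMoment 0 k s * (k : ℂ) ^ (2 * s + 1)‖
        ≤ ‖2 * s + 1‖ / k * (C₁ + ‖cosMomentLimit s‖) := by
          gcongr
          linarith
      _ = ‖2 * s + 1‖ * (C₁ + ‖cosMomentLimit s‖) / k := by ring
      _ ≤ D / k := by gcongr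
  · have e : (k : ℝ) ^ (-(2 * γ + 3 / 2)) =
        (k : ℝ) ^ (1 / 2 : ℝ) * ((k : ℝ) ^ (-(2 * γ + 1)) * (k : ℝ)⁻¹) := by
      rw [← Real.rpow_neg_one, ← Real.rpow_add hk0, ← Real.rpow_add hk0]
      congr 1; ring
    calc _ = μ.factorial * (Real.exp 2 * D) * Real.log k ^ μ *
          ((k : ℝ) ^ (-(2 * γ + 1)) * (k : ℝ)⁻¹) := by ring
      _ ≤ μ.factorial * (Real.exp 2 * D) * (C₂ * (k : ℝ) ^ (1 / 2 : ℝ)) *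
          ((k : ℝ) ^ (-(2 * γ + 1)) * (k : ℝ)⁻¹) := by gcongr
      _ = _ := by rw [e]; ring

/-! ### Cosine series of smooth even periodic functions -/

open scoped ContDiff in
-- Repeated integration by parts; periodicity cancels the boundary terms.
lemma exists_norm_fourierCoeffOn_le_div_pow (P : ℕ) (f : ℝ → ℂ) (hf : ContDiff ℝ ∞ f)
    (hper : f.Periodic (2 * Real.pi)) :
    ∃ C : ℝ, ∀ n : ℤ, n ≠ 0 →
      ‖fourierCoeffOn Real.two_pi_pos f n‖ ≤ C / |(n : ℝ)| ^ P := by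
  induction P generalizing f with
  | zero =>
    obtain ⟨C, hC⟩ := isCompact_Icc.exists_bound_of_continuousOn
      (hf.continuous.continuousOn (s := Icc 0 (2 * Real.pi)))
    refine ⟨C, fun n _ ↦ ?_⟩
    rw [fourierCoeffOn_eq_integral, pow_zero, div_one, norm_smul, sub_zero]
    have h2 := Real.two_pi_pos
    have := intervalIntegral.norm_integral_le_of_norm_le_const (a := 0) (b := 2 * Real.pi) (C := C)
      (f := fun x : ℝ ↦ fourier (-n) (x : AddCircle (2 * Real.pi - 0)) • f x) (fun x hx ↦ by
        rw [uIoc_of_le h2.le] at hx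
        rw [norm_smul, fourier_apply, Circle.norm_coe, one_mul]
        exact hC x (Ioc_subset_Icc_self hx))
    rw [sub_zero, abs_of_pos h2] at this
    rw [Real.norm_of_nonneg (by positivity)]
    calc _ ≤ 1 / (2 * Real.pi) * (C * (2 * Real.pi)) := by gcongr
      _ = C := by field_simp
  | succ P ih =>
    have hf' : ContDiff ℝ ∞ (deriv f) := (contDiff_infty_iff_deriv.mp hf).2
    have hper' : (deriv f).Periodic (2 * Real.pi) := fun x ↦ by
      rw [← deriv_comp_add_const]
      exact congrArg (deriv · x) (funext hper)
    obtain ⟨C, hC⟩ := ih (deriv f) hf' hper'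
    refine ⟨C, fun n hn ↦ ?_⟩
    have hfd : Differentiable ℝ f := hf.differentiable (by simp)
    rw [fourierCoeffOn_of_hasDerivAt Real.two_pi_pos hn (fun x _ ↦ (hfd x).hasDerivAt)
      (hf'.continuous.intervalIntegrable _ _)]
    have hend : f (2 * Real.pi) = f 0 := by simpa using hper 0
    have hn0 : 0 < |(n : ℝ)| := abs_pos.mpr (by exact_mod_cast hn)
    have hpi := Real.pi_pos
    rw [hend, sub_self, mul_zero, zero_sub, norm_mul, norm_neg, norm_mul]
    have e1 : ‖1 / (-2 * (Real.pi : ℂ) * Complex.I * n)‖ = 1 / (2 * Real.pi * |(n : ℝ)|) := by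
      simp [abs_of_pos hpi]
    have e2 : ‖((2 * Real.pi : ℝ) : ℂ) - ((0 : ℝ) : ℂ)‖ = 2 * Real.pi := by
      simp [abs_of_pos hpi]
    rw [e1, e2]
    calc _ ≤ 1 / (2 * Real.pi * |(n : ℝ)|) * (2 * Real.pi * (C / |(n : ℝ)| ^ P)) := by
          gcongr; exact hC n hn
      _ = _ := by field_simp; ring

open scoped ContDiff in
/-- A smooth even `2π`-periodic function is the sum of a cosine series with rapidly decreasing
coefficients. -/
theorem exists_hasSum_cos {G : ℝ → ℝ} (hG : ContDiff ℝ ∞ G) (hper : G.Periodic (2 * Real.pi))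
    (heven : ∀ θ, G (-θ) = G θ) :
    ∃ β : ℤ → ℝ, (∀ P : ℕ, Summable fun n : ℤ ↦ |β n| * (1 + |(n : ℝ)|) ^ P) ∧
      ∀ θ : ℝ, HasSum (fun n : ℤ ↦ β n * Real.cos (n * θ)) (G θ) := by
  have hT : Fact (0 < 2 * Real.pi) := ⟨Real.two_pi_pos⟩
  set f : ℝ → ℂ := fun θ ↦ (G θ : ℂ) with hf
  have hfc : ContDiff ℝ ∞ f := Complex.ofRealCLM.contDiff.comp hG
  have hfper : f.Periodic (2 * Real.pi) := fun θ ↦ by rw [hf]; exact congrArg _ (hper θ)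
  set c : ℤ → ℂ := fourierCoeffOn Real.two_pi_pos f with hc
  have hne : ∀ᶠ n : ℤ in cofinite, n ≠ 0 := (Set.finite_singleton (0 : ℤ)).compl_mem_cofinite
  have hsum : ∀ P : ℕ, Summable fun n : ℤ ↦ ‖c n‖ * (1 + |(n : ℝ)|) ^ P := by
    intro P
    -- Two powers beyond `P` leave the summable majorant `1/n²`.
    obtain ⟨C, hC⟩ := exists_norm_fourierCoeffOn_le_div_pow (P + 2) f hfc hfper
    have h2 : Summable fun n : ℤ ↦ C * 2 ^ P * (1 / (n : ℝ) ^ 2) :=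
      (Real.summable_one_div_int_pow.mpr one_lt_two).mul_left _
    refine h2.of_norm_bounded_eventually ?_
    filter_upwards [hne] with n hn
    have hn1 : 1 ≤ |(n : ℝ)| := by exact_mod_cast Int.one_le_abs hn
    rw [Real.norm_of_nonneg (by positivity)]
    calc ‖c n‖ * (1 + |(n : ℝ)|) ^ P ≤ C / |(n : ℝ)| ^ (P + 2) * (2 * |(n : ℝ)|) ^ P := by
          gcongr
          · exact (norm_nonneg _).trans (hC n hn)
          · exact hC n hn
          · linarith
      _ = C * 2 ^ P * (1 / |(n : ℝ)| ^ 2) := by field_simp; ring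
      _ = _ := by rw [sq_abs]
  let F : C(AddCircle (2 * Real.pi), ℂ) :=
    ⟨hfper.lift, continuous_coinduced_dom.mpr hfc.continuous⟩
  have hcoeff : fourierCoeff F = c := by
    funext n
    rw [fourierCoeff_eq_intervalIntegral _ n 0, hc, fourierCoeffOn_eq_integral, zero_add, sub_zero]
    congr 1
  have hsumc : Summable (fourierCoeff F) := by
    rw [hcoeff]
    exact Summable.of_norm (by simpa using hsum 0)
  have hpt : ∀ θ : ℝ, HasSum (fun n : ℤ ↦ c n * Complex.exp (n * θ * Complex.I)) (G θ : ℂ) := by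
    intro θ
    have h := has_pointwise_sum_fourier_series_of_summable hsumc (θ : AddCircle (2 * Real.pi))
    rw [hcoeff] at h
    have hpi : (Real.pi : ℂ) ≠ 0 := by exact_mod_cast Real.pi_ne_zero
    have hterm : ∀ n : ℤ, c n • fourier n (θ : AddCircle (2 * Real.pi)) =
        c n * Complex.exp (n * θ * Complex.I) := fun n ↦ by
      rw [fourier_coe_apply, smul_eq_mul]
      congr 2
      push_cast
      field_simp
    rw [funext hterm] at h
    exact h
  refine ⟨fun n ↦ (c n).re, fun P ↦ ?_, fun θ ↦ ?_⟩
  · refine (hsum P).of_nonneg_of_le (fun n ↦ by positivity) fun n ↦ ?_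
    gcongr
    exact Complex.abs_re_le_norm _
  -- Averaging the series at `θ` and `-θ` turns exponentials into cosines, so no symmetry of the
  -- coefficients has to be proved.
  · have h := ((hpt θ).add (hpt (-θ))).mul_left (1 / 2 : ℂ)
    have h' := Complex.reCLM.hasSum h
    rw [heven] at h'
    have hterm : ∀ n : ℤ, Complex.reCLM (1 / 2 * (c n * Complex.exp (n * θ * Complex.I) +
        c n * Complex.exp (n * ((-θ : ℝ) : ℂ) * Complex.I))) = (c n).re * Real.cos (n * θ) := by
      intro n
      have e : 1 / 2 * (c n * Complex.exp (n * θ * Complex.I) +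
          c n * Complex.exp (n * ((-θ : ℝ) : ℂ) * Complex.I)) =
          c n * ((Real.cos (n * θ) : ℝ) : ℂ) := by
        push_cast
        rw [Complex.cos]
        ring_nf
      rw [e, Complex.reCLM_apply, Complex.re_mul_ofReal]
    have hval : Complex.reCLM (1 / 2 * ((G θ : ℂ) + (G θ : ℂ))) = G θ := by
      rw [show (1 / 2 : ℂ) * ((G θ : ℂ) + (G θ : ℂ)) = (G θ : ℂ) by ring, Complex.reCLM_apply,
        Complex.ofReal_re]
    rw [hval] at h'
    exact (funext hterm) ▸ h'

/-! ### Real moments and the effect of a smooth factor -/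

lemma contDiff_comp_cos {g : ℝ → ℝ} (hg : AnalyticOn ℝ g (Icc (-1) 1)) (n : WithTop ℕ∞) :
    ContDiff ℝ n fun θ ↦ g (Real.cos θ) :=
  (hg.contDiffOn (uniqueDiffOn_Icc (by norm_num))).comp_contDiff Real.contDiff_cos
    fun θ ↦ ⟨Real.neg_one_le_cos θ, Real.cos_le_one θ⟩

/-- The real cosine moments of `(1 - cos θ) ^ γ * log (1 - cos θ) ^ μ` on `[0, π]`. -/
noncomputable def realCosMoment (γ : ℝ) (μ : ℕ) (n : ℤ) : ℝ :=
  ∫ θ in (0 : ℝ)..Real.pi,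
    (1 - Real.cos θ) ^ γ * Real.log (1 - Real.cos θ) ^ μ * Real.cos (n * θ)

lemma logWeight_ofReal (μ : ℕ) (γ θ : ℝ) :
    logWeight μ γ θ = (((1 - Real.cos θ) ^ γ * Real.log (1 - Real.cos θ) ^ μ : ℝ) : ℂ) := by
  rw [logWeight, Complex.ofReal_mul, Complex.ofReal_cpow (by linarith [Real.cos_le_one θ]),
    Complex.ofReal_pow]

lemma cosMoment_ofReal (γ : ℝ) (μ : ℕ) (n : ℤ) :
    cosMoment μ n γ = (realCosMoment γ μ n : ℂ) := by
  rw [cosMoment, realCosMoment, ← intervalIntegral.integral_ofReal]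
  refine intervalIntegral.integral_congr fun θ _ ↦ ?_
  simp only [logWeight_ofReal, Complex.ofReal_mul]

lemma realCosMoment_neg (γ : ℝ) (μ : ℕ) (n : ℤ) :
    realCosMoment γ μ (-n) = realCosMoment γ μ n := by
  simp only [realCosMoment, Int.cast_neg, neg_mul, Real.cos_neg]

lemma intervalIntegrable_weight {γ : ℝ} (hγ : -(1 / 2 : ℝ) < γ) (μ : ℕ) :
    IntervalIntegrable (fun θ ↦ (1 - Real.cos θ) ^ γ * Real.log (1 - Real.cos θ) ^ μ)
      MeasureTheory.volume 0 Real.pi := by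
  have h := intervalIntegrable_logWeight_mul μ (s := (γ : ℂ)) (by simpa using hγ)
    (u := fun _ ↦ 1) continuous_const
  simp only [logWeight_ofReal, mul_one] at h
  exact ⟨h.1.re, h.2.re⟩

/-- A form of Peetre's inequality: a shift by `i` costs only a polynomial factor in `|i|`, from `2 +
|j| ≤ (1 + |i|)(2 + |j + i|)`. -/
lemma two_add_abs_rpow_neg_le {q : ℝ} (hq : 0 ≤ q) (j i : ℤ) :
    (2 + |((j + i : ℤ) : ℝ)|) ^ (-q) ≤ (1 + |(i : ℝ)|) ^ q * (2 + |(j : ℝ)|) ^ (-q) := by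
  rw [Real.rpow_neg (by positivity), Real.rpow_neg (by positivity), ← div_eq_mul_inv,
    le_div_iff₀ (by positivity), inv_mul_le_iff₀ (by positivity),
    ← Real.mul_rpow (by positivity) (by positivity)]
  refine Real.rpow_le_rpow (by positivity) ?_ hq
  have h : |(j : ℝ)| ≤ |((j + i : ℤ) : ℝ)| + |(i : ℝ)| := by
    have := abs_sub ((j + i : ℤ) : ℝ) (i : ℝ)
    push_cast at this ⊢
    rwa [add_sub_cancel_right] at this
  nlinarith [abs_nonneg ((j + i : ℤ) : ℝ), abs_nonneg (i : ℝ)]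

/-- Telescoping over `m` unit steps, each compared with the one at `k`. Rounding `q` up gives an
integer power of `1 + m`, matching the summability available for the cosine coefficients. -/
lemma abs_add_natCast_sub_le {A : ℤ → ℝ} {C q : ℝ} (hq : 0 ≤ q) (hC : 0 ≤ C)
    (hA : ∀ j : ℤ, |A (j + 1) - A j| ≤ C * (2 + |(j : ℝ)|) ^ (-q)) (k : ℤ) (m : ℕ) :
    |A (k + m) - A k| ≤ C * (1 + (m : ℝ)) ^ (⌈q⌉₊ + 1) * (2 + |(k : ℝ)|) ^ (-q) := by
  have hsum : |A (k + m) - A k| ≤ ∑ i ∈ Finset.range m, |A (k + i + 1) - A (k + i)| := by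
    induction m with
    | zero => simp
    | succ m ih =>
      rw [Finset.sum_range_succ]
      have := abs_sub_le (A (k + (m + 1 : ℕ))) (A (k + m)) (A k)
      push_cast at this ⊢
      rw [← add_assoc] at this ⊢
      linarith
  have hterm : ∀ i ∈ Finset.range m, |A (k + i + 1) - A (k + i)| ≤
      C * (1 + (m : ℝ)) ^ ⌈q⌉₊ * (2 + |(k : ℝ)|) ^ (-q) := by
    intro i hi
    have him : (i : ℝ) ≤ m := by exact_mod_cast (Finset.mem_range.mp hi).le
    have h1 := (hA (k + i)).trans
      (mul_le_mul_of_nonneg_left (two_add_abs_rpow_neg_le hq k i) hC)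
    refine h1.trans ?_
    rw [← mul_assoc]
    gcongr
    rw [← Real.rpow_natCast]
    calc (1 + |((i : ℤ) : ℝ)|) ^ q ≤ (1 + (m : ℝ)) ^ q := by
          refine Real.rpow_le_rpow (by positivity) ?_ hq
          simpa using him
      _ ≤ (1 + (m : ℝ)) ^ (⌈q⌉₊ : ℝ) :=
          Real.rpow_le_rpow_of_exponent_le (by linarith [Nat.cast_nonneg (α := ℝ) m])
            (Nat.le_ceil q)
  refine hsum.trans ((Finset.sum_le_card_nsmul _ _ _ hterm).trans ?_)
  rw [Finset.card_range, nsmul_eq_mul, pow_succ]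
  have : 0 ≤ C * (1 + (m : ℝ)) ^ ⌈q⌉₊ * (2 + |(k : ℝ)|) ^ (-q) := by positivity
  nlinarith

lemma exists_abs_realCosMoment_succ_sub_le {γ : ℝ} (hγ : -(1 / 2 : ℝ) < γ) (μ : ℕ) :
    ∃ C : ℝ, 0 ≤ C ∧ ∀ j : ℤ, |realCosMoment γ μ (j + 1) - realCosMoment γ μ j| ≤
      C * (2 + |(j : ℝ)|) ^ (-(2 * γ + 3 / 2)) := by
  set q := 2 * γ + 3 / 2 with hq
  have hq0 : 0 ≤ q := by linarith
  obtain ⟨C, N, hC⟩ := exists_norm_cosMoment_succ_sub_le hγ μ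
  have hO : (fun k : ℕ ↦ realCosMoment γ μ (k + 1) - realCosMoment γ μ k) =O[atTop]
      fun k : ℕ ↦ (2 + (k : ℝ)) ^ (-q) := by
    refine IsBigO.of_bound (|C| * 3 ^ q) ?_
    filter_upwards [eventually_ge_atTop (max N 1)] with k hk
    have h := hC k (by omega)
    have hk1 : (1 : ℝ) ≤ k := by exact_mod_cast (by omega : 1 ≤ k)
    rw [cosMoment_ofReal, cosMoment_ofReal, ← Complex.ofReal_sub, Complex.norm_real] at h
    push_cast at h
    rw [Real.norm_of_nonneg (by positivity : 0 ≤ (2 + (k : ℝ)) ^ (-q)), mul_assoc]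
    refine h.trans (mul_le_mul (le_abs_self C) ?_ (by positivity) (abs_nonneg C))
    rw [Real.rpow_neg (by positivity), Real.rpow_neg (by positivity), ← div_eq_mul_inv,
      le_div_iff₀ (by positivity), inv_mul_le_iff₀ (by positivity),
      ← Real.mul_rpow (by positivity) (by positivity)]
    exact Real.rpow_le_rpow (by positivity) (by linarith) hq0
  obtain ⟨D, hD⟩ := (isBigO_nat_atTop_iff fun k h ↦ by
    have : (0 : ℝ) < (2 + (k : ℝ)) ^ (-q) := by positivity
    exact absurd h this.ne').mp hO
  have hD' : ∀ k : ℕ, |realCosMoment γ μ (k + 1) - realCosMoment γ μ k| ≤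
      |D| * (2 + (k : ℝ)) ^ (-q) := fun k ↦ by
    have := hD k
    rw [Real.norm_eq_abs, Real.norm_of_nonneg (by positivity : 0 ≤ (2 + (k : ℝ)) ^ (-q))] at this
    exact this.trans (by gcongr; exact le_abs_self D)
  -- Negative indices reduce to nonnegative ones by evenness; the reflection moves `|j|` by one, and
  -- `3 + m ≤ 2(2 + m)` accounts for `2^q`.
  refine ⟨|D| * 2 ^ q, by positivity, fun j ↦ ?_⟩
  have h2q : (1 : ℝ) ≤ 2 ^ q := Real.one_le_rpow one_le_two hq0
  rcases j with m | m
  · refine (hD' m).trans ?_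
    simp only [Int.ofNat_eq_natCast, Int.cast_natCast, Nat.abs_cast]
    rw [mul_assoc]
    exact mul_le_mul_of_nonneg_left (le_mul_of_one_le_left (by positivity) h2q) (abs_nonneg D)
  · have e1 : Int.negSucc m + 1 = -(m : ℤ) := by omega
    have e2 : Int.negSucc m = -((m : ℤ) + 1) := by omega
    have h := hD' m
    rw [e1, e2, realCosMoment_neg, realCosMoment_neg, abs_sub_comm]
    refine h.trans ?_
    rw [mul_assoc]
    refine mul_le_mul_of_nonneg_left ?_ (abs_nonneg D)
    have e3 : |((-((m : ℤ) + 1) : ℤ) : ℝ)| = (m : ℝ) + 1 := by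
      push_cast; rw [abs_neg, abs_of_nonneg (by positivity)]
    rw [e3, Real.rpow_neg (by positivity), Real.rpow_neg (by positivity), ← div_eq_mul_inv,
      le_div_iff₀ (by positivity), inv_mul_le_iff₀ (by positivity),
      ← Real.mul_rpow (by positivity) (by positivity)]
    exact Real.rpow_le_rpow (by positivity) (by linarith [Nat.cast_nonneg (α := ℝ) m]) hq0

/-- Multiplying the weight by a smooth even function `G` multiplies its `k`-th cosine moment by
`G 0`, up to an error of relative order `k ^ (-1/2)`. -/
theorem exists_abs_integral_weight_mul_sub_le {γ : ℝ} (hγ : -(1 / 2 : ℝ) < γ) (μ : ℕ) {G : ℝ → ℝ}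
    {β : ℤ → ℝ} (hβ : ∀ P : ℕ, Summable fun n : ℤ ↦ |β n| * (1 + |(n : ℝ)|) ^ P)
    (hG : ∀ θ : ℝ, HasSum (fun n : ℤ ↦ β n * Real.cos (n * θ)) (G θ)) :
    ∃ C : ℝ, ∀ k : ℕ, |(∫ θ in (0 : ℝ)..Real.pi, (1 - Real.cos θ) ^ γ *
        Real.log (1 - Real.cos θ) ^ μ * (G θ * Real.cos (k * θ))) - G 0 * realCosMoment γ μ k| ≤
      C * (2 + (k : ℝ)) ^ (-(2 * γ + 3 / 2)) := by
  set q := 2 * γ + 3 / 2 with hq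
  set w : ℝ → ℝ := fun θ ↦ (1 - Real.cos θ) ^ γ * Real.log (1 - Real.cos θ) ^ μ with hw
  have hwint : IntervalIntegrable w MeasureTheory.volume 0 Real.pi := intervalIntegrable_weight hγ μ
  obtain ⟨C, hC, hA⟩ := exists_abs_realCosMoment_succ_sub_le hγ μ
  have hq0 : 0 ≤ q := by linarith
  rw [← hq] at hA
  clear_value q
  set A := realCosMoment γ μ with hAdef
  have hshift : ∀ (k : ℕ) (n : ℤ), |A (k + n) - A k| ≤
      C * (1 + |(n : ℝ)|) ^ (⌈q⌉₊ + 1) * (2 + (k : ℝ)) ^ (-q) := by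
    intro k n
    obtain ⟨m, rfl | rfl⟩ := n.eq_nat_or_neg
    · simpa using abs_add_natCast_sub_le hq0 hC hA k m
    -- A shift to the left from `k` is a shift to the right from `-k`, since the moments are even in
    -- the index.
    · have h := abs_add_natCast_sub_le hq0 hC hA (-k) m
      rw [show -(k : ℤ) + m = -((k : ℤ) + -m) by ring, hAdef, realCosMoment_neg,
        realCosMoment_neg] at h
      simpa using h
  have hS : Summable fun n ↦ |β n| := by simpa using hβ 0
  refine ⟨C * ∑' n : ℤ, |β n| * (1 + |(n : ℝ)|) ^ (⌈q⌉₊ + 1), fun k ↦ ?_⟩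
  have hcosint : ∀ m : ℤ, IntervalIntegrable (fun θ ↦ w θ * Real.cos (m * θ))
      MeasureTheory.volume 0 Real.pi := fun m ↦
    hwint.mul_continuousOn (by fun_prop)
  have hterm : ∀ n : ℤ, ∫ θ in (0 : ℝ)..Real.pi,
      w θ * (β n * Real.cos (n * θ) * Real.cos (k * θ)) = β n * ((A (k + n) + A (k + -n)) / 2) := by
    intro n
    have e : ∀ θ, w θ * (β n * Real.cos (n * θ) * Real.cos (k * θ)) =
        β n / 2 * (w θ * Real.cos (((k + n : ℤ) : ℝ) * θ) +
          w θ * Real.cos (((k + -n : ℤ) : ℝ) * θ)) := by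
      intro θ
      push_cast
      rw [add_mul, add_mul, neg_mul, ← sub_eq_add_neg, Real.cos_add, Real.cos_sub]
      ring
    simp only [e]
    rw [intervalIntegral.integral_const_mul, intervalIntegral.integral_add (hcosint _) (hcosint _)]
    change _ * (A _ + A _) = _
    ring
  have hI : HasSum (fun n : ℤ ↦ β n * ((A (k + n) + A (k + -n)) / 2))
      (∫ θ in (0 : ℝ)..Real.pi, w θ * (G θ * Real.cos (k * θ))) := by
    simp only [← hterm]
    refine intervalIntegral.hasSum_integral_of_dominated_convergence
      (fun n θ ↦ |β n| * |w θ|) (fun n ↦ ?_) (fun n ↦ ?_) ?_ ?_ ?_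
    · exact (intervalIntegrable_iff.mp
        (hwint.mul_continuousOn (by fun_prop))).aestronglyMeasurable
    · refine Eventually.of_forall fun θ _ ↦ ?_
      rw [norm_mul, Real.norm_eq_abs, Real.norm_eq_abs, mul_comm]
      refine mul_le_mul_of_nonneg_right ?_ (abs_nonneg _)
      rw [mul_assoc, abs_mul, abs_mul]
      refine mul_le_of_le_one_right (abs_nonneg _) ?_
      exact mul_le_one₀ (Real.abs_cos_le_one _) (abs_nonneg _) (Real.abs_cos_le_one _)
    · exact Eventually.of_forall fun θ _ ↦ hS.mul_right _
    · simp only [tsum_mul_right]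
      exact hwint.abs.const_mul _
    · exact Eventually.of_forall fun θ _ ↦ ((hG θ).mul_right _).mul_left _
  have h0 : HasSum (fun n : ℤ ↦ β n * A k) (G 0 * A k) := by
    have := (hG 0).mul_right (A k)
    simpa using this
  have hdiff := hI.sub h0
  have hbound : HasSum (fun n : ℤ ↦ C * (2 + (k : ℝ)) ^ (-q) *
      (|β n| * (1 + |(n : ℝ)|) ^ (⌈q⌉₊ + 1)))
      (C * (2 + (k : ℝ)) ^ (-q) * ∑' n : ℤ, |β n| * (1 + |(n : ℝ)|) ^ (⌈q⌉₊ + 1)) :=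
    (hβ _).hasSum.mul_left _
  have hfin := hdiff.norm_le_of_bounded hbound fun n ↦ by
    have h1 := hshift k n
    have h2 := hshift k (-n)
    rw [Int.cast_neg, abs_neg] at h2
    have e : β n * ((A (k + n) + A (k + -n)) / 2) - β n * A k =
        β n * (((A (k + n) - A k) + (A (k + -n) - A k)) / 2) := by ring
    rw [e, norm_mul, Real.norm_eq_abs, Real.norm_eq_abs, abs_div, abs_two]
    have h3 := abs_add_le (A (k + n) - A k) (A (k + -n) - A k)
    calc |β n| * (|(A (k + n) - A k) + (A (k + -n) - A k)| / 2) ≤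
        |β n| * (C * (1 + |(n : ℝ)|) ^ (⌈q⌉₊ + 1) * (2 + (k : ℝ)) ^ (-q)) := by
          gcongr; linarith
      _ = _ := by ring
  rw [Real.norm_eq_abs] at hfin
  refine hfin.trans_eq (by ring)

/-! ### From Chebyshev coefficients to cosine moments -/

/-- The Jacobian `-sin θ` cancels `√(1 - x²)`. The interval is open because at its endpoints the
left side vanishes while the right side need not. -/
lemma chebyshevIntegrand_cos_mul {γ : ℝ} {μ : ℕ} {g₁ f : ℝ → ℝ}
    (hf : ∀ x ∈ Ico (-1 : ℝ) 1, f x = (1 - x) ^ γ * Real.log (1 - x) ^ μ * g₁ x) (k : ℕ) {θ : ℝ}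
    (hθ : θ ∈ Ioo 0 Real.pi) :
    (chebyshevIntegrand f k ∘ Real.cos) θ * -Real.sin θ =
      -((1 - Real.cos θ) ^ γ * Real.log (1 - Real.cos θ) ^ μ *
        (g₁ (Real.cos θ) * Real.cos (k * θ))) := by
  have hs := Real.sin_pos_of_mem_Ioo hθ
  have hc : Real.cos θ ∈ Ico (-1 : ℝ) 1 :=
    ⟨Real.neg_one_le_cos θ, by linarith [(one_sub_cos_mem_Ioc ⟨hθ.1, hθ.2.le⟩).1]⟩
  have hsqrt : √(1 - Real.cos θ ^ 2) = Real.sin θ := by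
    rw [← Real.sin_sq, Real.sqrt_sq hs.le]
  rw [Function.comp_apply, chebyshevIntegrand, hf _ hc, hsqrt,
    Polynomial.Chebyshev.T_real_cos, Int.cast_natCast]
  field_simp

lemma intervalIntegrable_chebyshevIntegrand {γ : ℝ} (hγ : -(1 / 2 : ℝ) < γ) {μ : ℕ} {g₁ f : ℝ → ℝ}
    (hg : Continuous fun θ ↦ g₁ (Real.cos θ))
    (hf : ∀ x ∈ Ico (-1 : ℝ) 1, f x = (1 - x) ^ γ * Real.log (1 - x) ^ μ * g₁ x) (k : ℕ) :
    IntervalIntegrable (chebyshevIntegrand f k) MeasureTheory.volume (-1) 1 := by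
  have h := (intervalIntegral.integrable_comp_mul_deriv_iff_of_deriv_nonpos (a := 0) (b := Real.pi)
    (f := Real.cos) (f' := fun θ ↦ -Real.sin θ) (g := chebyshevIntegrand f k)
    Real.continuous_cos.continuousOn (fun θ _ ↦ Real.hasDerivAt_cos θ) (fun θ hθ ↦ by
      rw [min_eq_left Real.pi_pos.le, max_eq_right Real.pi_pos.le] at hθ
      exact neg_nonpos.mpr (Real.sin_pos_of_mem_Ioo hθ).le)).mp ?_
  · rw [Real.cos_zero, Real.cos_pi] at h
    exact h.symm
  · refine IntervalIntegrable.congr_uIoo ((intervalIntegrable_weight hγ μ).mul_continuousOn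
      (g := fun θ ↦ g₁ (Real.cos θ) * Real.cos (k * θ)) ?_).neg fun θ hθ ↦ ?_
    · exact (hg.mul (by fun_prop)).continuousOn
    · rw [uIoo_of_le Real.pi_pos.le] at hθ
      exact (chebyshevIntegrand_cos_mul hf k hθ).symm

lemma chebyshevCoeff_eq_integral {γ : ℝ} {μ : ℕ} {g₁ f : ℝ → ℝ}
    (hf : ∀ x ∈ Ico (-1 : ℝ) 1, f x = (1 - x) ^ γ * Real.log (1 - x) ^ μ * g₁ x) (k : ℕ) :
    chebyshevCoeff f k = 2 / Real.pi * ∫ θ in (0 : ℝ)..Real.pi,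
      (1 - Real.cos θ) ^ γ * Real.log (1 - Real.cos θ) ^ μ *
        (g₁ (Real.cos θ) * Real.cos (k * θ)) := by
  have h := intervalIntegral.integral_comp_mul_deriv_of_deriv_nonpos (a := 0) (b := Real.pi)
    (f := Real.cos) (f' := fun θ ↦ -Real.sin θ) (g := chebyshevIntegrand f k)
    Real.continuous_cos.continuousOn (fun θ _ ↦ Real.hasDerivAt_cos θ) (fun θ hθ ↦ by
      rw [min_eq_left Real.pi_pos.le, max_eq_right Real.pi_pos.le] at hθ
      exact neg_nonpos.mpr (Real.sin_pos_of_mem_Ioo hθ).le)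
  rw [intervalIntegral.integral_congr_Ioo_of_le Real.pi_pos.le
    fun θ hθ ↦ chebyshevIntegrand_cos_mul hf k hθ, intervalIntegral.integral_neg, Real.cos_zero,
    Real.cos_pi, intervalIntegral.integral_symm (-1) 1, neg_inj] at h
  rw [chebyshevCoeff, ← h]

lemma cosMomentLimit_ofReal (x : ℝ) : cosMomentLimit x =
    ((-(2 ^ (-x) * Real.Gamma (2 * x + 1) * Real.sin (x * Real.pi)) : ℝ) : ℂ) := by
  rw [cosMomentLimit]
  push_cast [Complex.ofReal_cpow, ← Complex.Gamma_ofReal]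
  rw [Complex.ofReal_cpow (by norm_num)]
  push_cast
  rw [mul_comm (Real.pi : ℂ)]

/-- The complex derivative at a real point is the derivative along the real axis, where the product
rule applies to the real closed form. -/
lemma deriv_cosMomentLimit_ofReal {γ : ℝ} (hγ : -(1 / 2 : ℝ) < γ) : deriv cosMomentLimit γ =
    ((-(2 ^ (-γ) * (2 * Real.sin (γ * Real.pi) * deriv Real.Gamma (2 * γ + 1) +
      (Real.pi * Real.cos (γ * Real.pi) - Real.log 2 * Real.sin (γ * Real.pi)) *
        Real.Gamma (2 * γ + 1))) : ℝ) : ℂ) := by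
  have hC : HasDerivAt (fun x : ℝ ↦ cosMomentLimit x) (deriv cosMomentLimit γ) γ :=
    (differentiableOn_cosMomentLimit.differentiableAt
      (isOpen_neg_half_lt_re.mem_nhds (by simpa using hγ))).hasDerivAt.comp_ofReal
  have hΓ : HasDerivAt Real.Gamma (deriv Real.Gamma (2 * γ + 1)) (2 * γ + 1) := by
    refine (Real.differentiableAt_Gamma fun m h ↦ ?_).hasDerivAt
    have : (0 : ℝ) ≤ m := by positivity
    linarith
  have hlin : HasDerivAt (fun x : ℝ ↦ 2 * x + 1) 2 γ := by
    simpa using ((hasDerivAt_id γ).const_mul 2).add_const 1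
  have h1 : HasDerivAt (fun x : ℝ ↦ Real.Gamma (2 * x + 1)) (deriv Real.Gamma (2 * γ + 1) * 2) γ :=
    HasDerivAt.comp (h₂ := Real.Gamma) γ hΓ hlin
  have h2 : HasDerivAt (fun x : ℝ ↦ (2 : ℝ) ^ (-x)) (Real.log 2 * (-1) * 2 ^ (-γ)) γ := by
    simpa using (hasDerivAt_id γ).neg.const_rpow (a := 2) (by norm_num)
  have h3 : HasDerivAt (fun x : ℝ ↦ Real.sin (x * Real.pi))
      (Real.cos (γ * Real.pi) * Real.pi) γ := by
    simpa using ((hasDerivAt_id γ).mul_const Real.pi).sin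
  have hR := ((h2.fun_mul h1).fun_mul h3).fun_neg.ofReal_comp
  rw [funext cosMomentLimit_ofReal] at hC
  rw [hC.unique hR]
  congr 1
  ring

lemma exists_abs_realCosMoment_sub_le {γ : ℝ} (hγ : -(1 / 2 : ℝ) < γ) (μ : ℕ) :
    ∃ C : ℝ, ∃ N : ℕ, ∀ k : ℕ, N ≤ k →
      |realCosMoment γ μ k - ((-2 * Real.log k) ^ μ *
          -(2 ^ (-γ) * Real.Gamma (2 * γ + 1) * Real.sin (γ * Real.pi)) +
        μ * -(2 ^ (-γ) * (2 * Real.sin (γ * Real.pi) * deriv Real.Gamma (2 * γ + 1) +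
          (Real.pi * Real.cos (γ * Real.pi) - Real.log 2 * Real.sin (γ * Real.pi)) *
            Real.Gamma (2 * γ + 1))) * (-2 * Real.log k) ^ (μ - 1)) *
          (k : ℝ) ^ (-(2 * γ + 1))| ≤
      C * (Real.log k ^ ((μ : ℤ) - 2) * (k : ℝ) ^ (-(2 * γ + 1))) := by
  obtain ⟨C, N, h⟩ := exists_norm_cosMoment_sub_le hγ μ
  refine ⟨C, N, fun k hk ↦ le_of_eq_of_le ?_ (h k hk)⟩
  rw [cosMoment_ofReal, cosMomentLimit_ofReal, deriv_cosMomentLimit_ofReal hγ, ← Real.norm_eq_abs,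
    ← Complex.norm_real]
  congr 1
  push_cast
  ring

/-- The worst case is `μ = 1`, where the exponent is `-1`; `k ≥ 3` ensures `log k ≥ 1`, so larger
`μ` only helps. -/
lemma rpow_neg_half_le_two_mul_log_zpow {k μ : ℕ} (hμ : 1 ≤ μ) (hk : 3 ≤ k) :
    (k : ℝ) ^ (-(1 / 2 : ℝ)) ≤ 2 * Real.log k ^ ((μ : ℤ) - 2) := by
  have hk3 : (3 : ℝ) ≤ k := by exact_mod_cast hk
  have hk0 : (0 : ℝ) < k := by linarith
  have hL1 : 1 ≤ Real.log k := by
    rw [Real.le_log_iff_exp_le hk0]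
    linarith [Real.exp_one_lt_three]
  have hL : 0 < Real.log k := by linarith
  have h1 : Real.log k ^ (-1 : ℤ) ≤ Real.log k ^ ((μ : ℤ) - 2) :=
    zpow_le_zpow_right₀ hL1 (by omega)
  have h2 : Real.log k ≤ 2 * (k : ℝ) ^ (1 / 2 : ℝ) := by
    rw [← Real.sqrt_eq_rpow]
    refine abs_le_of_sq_le_sq' ?_ (by positivity) |>.2
    rw [mul_pow, Real.sq_sqrt hk0.le]
    linarith [log_sq_le_four_mul k]
  rw [zpow_neg_one] at h1
  refine le_trans ?_ (mul_le_mul_of_nonneg_left h1 zero_le_two)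
  rw [Real.rpow_neg hk0.le, ← div_eq_mul_inv, le_div_iff₀ hL, inv_mul_le_iff₀ (by positivity)]
  linarith

theorem mainTheorem3 (γ : ℝ) (hγ : -(1 / 2 : ℝ) < γ) (μ : ℕ) (hμ : 1 ≤ μ)
    (g₁ : ℝ → ℝ) (hg₁ : AnalyticOn ℝ g₁ (Icc (-1) 1))
    (f : ℝ → ℝ)
    (hf : ∀ x ∈ Ico (-1 : ℝ) 1, f x = (1 - x) ^ γ * Real.log (1 - x) ^ μ * g₁ x) :
    (∀ k : ℕ, IntervalIntegrable (chebyshevIntegrand f k) MeasureTheory.volume (-1) 1) ∧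
    (fun k : ℕ =>
        chebyshevCoeff f k -
          ((2 : ℝ) ^ ((μ : ℝ) + 1 - γ) / Real.pi * g₁ 1 * (-1) ^ (μ + 1) *
              Real.sin (γ * Real.pi) * Real.Gamma (2 * γ + 1) *
              (Real.log k ^ μ / (k : ℝ) ^ (2 * γ + 1)) +
            (-1) ^ μ * (μ : ℝ) * (2 : ℝ) ^ ((μ : ℝ) - γ) * g₁ 1 *
              (2 / Real.pi * Real.sin (γ * Real.pi) * deriv Real.Gamma (2 * γ + 1) +
                (Real.cos (γ * Real.pi) - Real.log 2 / Real.pi * Real.sin (γ * Real.pi)) *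
                  Real.Gamma (2 * γ + 1)) *
              (Real.log k ^ (μ - 1) / (k : ℝ) ^ (2 * γ + 1))))
      =O[atTop]
        (fun k : ℕ => Real.log k ^ ((μ : ℤ) - 2) / (k : ℝ) ^ (2 * γ + 1)) := by
  refine ⟨intervalIntegrable_chebyshevIntegrand hγ (contDiff_comp_cos hg₁ 0).continuous hf, ?_⟩
  obtain ⟨β, hβ, hG⟩ := exists_hasSum_cos (contDiff_comp_cos hg₁ _)
    (fun θ ↦ by rw [Real.cos_add_two_pi]) (fun θ ↦ by rw [Real.cos_neg])
  obtain ⟨C₁, hC₁⟩ := exists_abs_integral_weight_mul_sub_le hγ μ hβ hG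
  obtain ⟨C₂, N, hC₂⟩ := exists_abs_realCosMoment_sub_le hγ μ
  rw [Real.cos_zero] at hC₁
  have hpi := Real.pi_pos
  -- The first summand is the cost of replacing `g₁(cos θ)` by `g₁(1)`, the second that of replacing
  -- the moment by its two-term expansion.
  refine IsBigO.of_bound (2 / Real.pi * (|C₁| * 2 + |g₁ 1| * C₂)) ?_
  filter_upwards [eventually_ge_atTop (max N 3)] with k hk
  have hk3 : 3 ≤ k := by omega
  have hk1 : (1 : ℝ) < k := by exact_mod_cast (by omega : 1 < k)
  have hk0 : (0 : ℝ) < k := by linarith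
  have hL : 0 < Real.log k := Real.log_pos hk1
  have h1 := hC₁ k
  have h2 := hC₂ k (by omega)
  rw [chebyshevCoeff_eq_integral hf, Real.norm_eq_abs, Real.norm_of_nonneg (by positivity)]
  set I := ∫ θ in (0 : ℝ)..Real.pi, (1 - Real.cos θ) ^ γ * Real.log (1 - Real.cos θ) ^ μ *
        (g₁ (Real.cos θ) * Real.cos (k * θ))
  set M := ((-2 * Real.log k) ^ μ *
          -(2 ^ (-γ) * Real.Gamma (2 * γ + 1) * Real.sin (γ * Real.pi)) +
        μ * -(2 ^ (-γ) * (2 * Real.sin (γ * Real.pi) * deriv Real.Gamma (2 * γ + 1) +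
          (Real.pi * Real.cos (γ * Real.pi) - Real.log 2 * Real.sin (γ * Real.pi)) *
            Real.Gamma (2 * γ + 1))) * (-2 * Real.log k) ^ (μ - 1)) *
          (k : ℝ) ^ (-(2 * γ + 1)) with hM
  have hmain : 2 / Real.pi * (g₁ 1 * M) =
      (2 : ℝ) ^ ((μ : ℝ) + 1 - γ) / Real.pi * g₁ 1 * (-1) ^ (μ + 1) *
              Real.sin (γ * Real.pi) * Real.Gamma (2 * γ + 1) *
              (Real.log k ^ μ / (k : ℝ) ^ (2 * γ + 1)) +
            (-1) ^ μ * (μ : ℝ) * (2 : ℝ) ^ ((μ : ℝ) - γ) * g₁ 1 *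
              (2 / Real.pi * Real.sin (γ * Real.pi) * deriv Real.Gamma (2 * γ + 1) +
                (Real.cos (γ * Real.pi) - Real.log 2 / Real.pi * Real.sin (γ * Real.pi)) *
                  Real.Gamma (2 * γ + 1)) *
              (Real.log k ^ (μ - 1) / (k : ℝ) ^ (2 * γ + 1)) := by
    have e1 : (2 : ℝ) ^ ((μ : ℝ) + 1 - γ) = 2 ^ μ * 2 * 2 ^ (-γ) := by
      rw [sub_eq_add_neg, Real.rpow_add two_pos, Real.rpow_add two_pos, Real.rpow_natCast,
        Real.rpow_one]
    have e2 : (2 : ℝ) ^ ((μ : ℝ) - γ) = 2 ^ μ * 2 ^ (-γ) := by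
      rw [sub_eq_add_neg, Real.rpow_add two_pos, Real.rpow_natCast]
    rw [e1, e2, hM, Real.rpow_neg hk0.le]
    -- Writing `μ = m + 1` removes the truncated subtraction in `μ - 1`.
    obtain ⟨m, rfl⟩ := Nat.exists_eq_add_of_le' hμ
    have e3 : (-2 * Real.log k) = (-1) * (2 * Real.log k) := by ring
    rw [e3, Nat.add_sub_cancel]
    simp only [mul_pow, pow_succ]
    field_simp
  rw [← hmain, ← mul_sub, abs_mul, abs_of_pos (by positivity : 0 < 2 / Real.pi), mul_assoc]
  refine mul_le_mul_of_nonneg_left ?_ (by positivity)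
  have h3 : (2 + (k : ℝ)) ^ (-(2 * γ + 3 / 2)) ≤
      2 * (Real.log k ^ ((μ : ℤ) - 2) * (k : ℝ) ^ (-(2 * γ + 1))) := by
    calc (2 + (k : ℝ)) ^ (-(2 * γ + 3 / 2)) ≤ (k : ℝ) ^ (-(2 * γ + 3 / 2)) :=
          Real.rpow_le_rpow_of_nonpos hk0 (by linarith) (by linarith)
      _ = (k : ℝ) ^ (-(1 / 2 : ℝ)) * (k : ℝ) ^ (-(2 * γ + 1)) := by
          rw [← Real.rpow_add hk0]; congr 1; ring
      _ ≤ 2 * Real.log k ^ ((μ : ℤ) - 2) * (k : ℝ) ^ (-(2 * γ + 1)) := by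
          gcongr
          exact rpow_neg_half_le_two_mul_log_zpow hμ hk3
      _ = _ := by ring
  rw [div_eq_mul_inv, ← Real.rpow_neg hk0.le]
  set E := Real.log k ^ ((μ : ℤ) - 2) * (k : ℝ) ^ (-(2 * γ + 1)) with hE
  calc |I - g₁ 1 * M| = |(I - g₁ 1 * realCosMoment γ μ k) + g₁ 1 * (realCosMoment γ μ k - M)| := by
        congr 1; ring
    _ ≤ |I - g₁ 1 * realCosMoment γ μ k| + |g₁ 1| * |realCosMoment γ μ k - M| := by
        rw [← abs_mul]; exact abs_add_le _ _
    _ ≤ |C₁| * (2 * E) + |g₁ 1| * (C₂ * E) := by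
        gcongr
        exact h1.trans ((mul_le_mul_of_nonneg_right (le_abs_self _) (by positivity)).trans
          (mul_le_mul_of_nonneg_left h3 (abs_nonneg _)))
    _ = _ := by ring
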